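/- Let $G$ be a compact (Hausdorff) group with normalized Haar measure $\mu_G$, let $[G]$ be the set of its conjugacy classes (with the quotient topology), and let $z:[G]\to\mathbb{C}\setminus\{0\}$ be continuous; $z$ is also regarded as a central function on $G$. Put $I=\int_G|z(g)|^2\,d\mu_G(g)$. Let $S_n(G)=G^n\rtimes S_n$ be the wreath product, with multiplication $(g,s)(h,t)=((g_ih_{s^{-1}(i)})_i,st)$. For $x=((g_1,\dots,g_n),s)\in S_n(G)$, the colour of a cycle $(i_1i_2\cdots i_r)$ of $s$ (fixed points included) is the conjugacy class of $g_{i_r}\cdots g_{i_2}g_{i_1}$, and $[x](c)$ is the number of cycles of $s$ of colour $c\in[G]$. Let $\mu_{S_n(G)}$ be the product of the normalized Haar measures on the factors $G$ and the uniform distribution on $S_n$. The Ewens measure on $S_n(G)$ is $$d\mu^{\mathrm{Ewens}}_{S_n(G)}(x)=n!\,\frac{\prod_{c\in[G]}\bigl(z(c)\overline{z(c)}\bigr)^{[x](c)}}{I(I+1)\cdots(I+n-1)}\,d\mu_{S_n(G)}(x).$$ The canonical projection $p_{n,n+1}:S_{n+1}(G)\to S_n(G)$ removes the point $n+1$ from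 its cycle $\cdots\to i_m\to n+1\to i_{m+1}\to\cdots$, deletes the entry $g_{n+1}$ and replaces $g_{i_{m+1}}$ by $g_{i_{m+1}}g_{n+1}$; if $n+1$ is a fixed point, it is removed together with $g_{n+1}$. Let $\mathfrak{S}_G=\varprojlim S_n(G)$, the space of $G$-virtual permutations, be the space of sequences $x=(x_n)$ with $x_n\in S_n(G)$ and $p_{n,n+1}(x_{n+1})=x_n$, with its projective limit topology and Borel $\sigma$-algebra. Let $S_\infty(G)=\bigcup_nS_n(G)$ be the group of pairs $(g,s)$ where $g\in G^\infty$ has finitely many entries different from $e_G$ and $s$ is a finite permutation of $\{1,2,\dots\}$. For $W=(w_1,w_2)\in S_\infty(G)\times S_\infty(G)$ and $x\in\mathfrak{S}_G$ let $xW\in\mathfrak{S}_G$ be the element with $(xW)_n=w_2^{-1}x_nw_1$ for all $n$ with $w_1,w_2\in S_n(G)$. For $c\in[G]$ put $C_c(x,W)=[(xW)_n](c)-[x_n](c)$, for $n$ so large that $w_1,w_2\in S_n(G)$. Then $C_c(x,W)$ does not depend on the choice of such $n$; there is a unique probability measure $\mu^{\mathrm{Ewens}}_{\mathfrak{S}_G}=\varprojlim\mu^{\mathrm{Ewens}}_{S_n(G)}$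 on $\mathfrak{S}_G$ whose image in $S_n(G)$ is $\mu^{\mathrm{Ewens}}_{S_n(G)}$ for every $n$; and this measure is quasi-invariant with respect to the action of $S_\infty(G)\times S_\infty(G)$ on $\mathfrak{S}_G$. More precisely, for every $W\in S_\infty(G)\times S_\infty(G)$, $$\frac{d\mu^{\mathrm{Ewens}}_{\mathfrak{S}_G}(xW)}{d\mu^{\mathrm{Ewens}}_{\mathfrak{S}_G}(x)}=\prod_{c\in[G]}\bigl(z(c)\overline{z(c)}\bigr)^{C_c(x,W)},$$ that is, for every Borel set $V\subseteq\mathfrak{S}_G$ the set $VW$ is Borel and $$\mu^{\mathrm{Ewens}}_{\mathfrak{S}_G}(VW)=\int_V\prod_{c\in[G]}\bigl(z(c)\overline{z(c)}\bigr)^{C_c(x,W)}\,d\mu^{\mathrm{Ewens}}_{\mathfrak{S}_G}(x).$$ -/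

import Mathlib

open MeasureTheory

noncomputable section

namespace WreathEwens

/-! ### Wreath products -/

/-- The unrestricted wreath product of `G` with the permutations of `ι`, with underlying set
`(ι → G) × Perm ι` and multiplication `(g, s) (h, t) = (g · s(h), s t)`, where
`s(h) i = h (s⁻¹ i)`. -/
abbrev Wreath (G ι : Type*) [Group G] : Type _ :=
  (ι → G) ⋊[mulAutArrow] Equiv.Perm ι

/-- The wreath product `S_n(G)`; the indices `1, …, n` are represented by `Fin n`. -/
abbrev SG (G : Type*) [Group G] (n : ℕ) : Type _ := Wreath G (Fin n)

section Group

variable {G : Type*} [Group G]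

theorem mul_left_apply {ι : Type*} (x y : Wreath G ι) (i : ι) :
    (x * y).left i = x.left i * y.left (x.right⁻¹ i) := rfl

theorem wreath_ext {ι : Type*} {x y : Wreath G ι} (h : ∀ i, x.left i = y.left i)
    (h' : ∀ i, x.right i = y.right i) : x = y :=
  SemidirectProduct.ext (funext h) (Equiv.ext h')

variable (G) in
/-- The infinite wreath product `S_∞(G)`: the pairs `(g, s)` in which `g` has only finitely many
entries different from `1` and `s` moves only finitely many points. -/
def SInf : Subgroup (Wreath G ℕ) where
  carrier := {x | {i | x.left i ≠ 1}.Finite ∧ {i | x.right i ≠ i}.Finite}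
  one_mem' := by simp
  mul_mem' := by
    rintro x y ⟨hx, hx'⟩ ⟨hy, hy'⟩
    constructor
    · refine ((hx.union (hy.image x.right))).subset fun i hi => ?_
      by_contra hcon
      simp only [Set.mem_union, Set.mem_ofPred_eq, Set.mem_image, not_or, not_exists, not_and,
        not_not] at hcon
      refine hi ?_
      rw [mul_left_apply, hcon.1, one_mul]
      by_contra h
      exact hcon.2 _ h (by simp)
    · refine ((hx'.union hy')).subset fun i hi => ?_
      by_contra hcon
      simp only [Set.mem_union, Set.mem_ofPred_eq, not_or, not_not] at hcon
      refine hi ?_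
      simp [hcon.1, hcon.2]
  inv_mem' := by
    rintro x ⟨hx, hx'⟩
    constructor
    · refine (hx.image x.right.symm).subset fun i hi => ⟨x.right i, ?_, by simp⟩
      intro h
      apply hi
      change (x.left (x.right⁻¹⁻¹ i))⁻¹ = 1
      simp [h]
    · refine hx'.subset fun i hi => ?_
      intro h
      apply hi
      change x.right⁻¹ i = i
      rw [Equiv.Perm.inv_eq_iff_eq]
      exact h.symm

/-- Extension of a permutation of `Fin n` to `ℕ` by fixed points. -/
def extendPerm (n : ℕ) (s : Equiv.Perm (Fin n)) : Equiv.Perm ℕ :=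
  s.extendDomain (p := fun i : ℕ => i < n) Fin.equivSubtype

theorem extendPerm_of_lt {n : ℕ} (s : Equiv.Perm (Fin n)) {i : ℕ} (h : i < n) :
    extendPerm n s i = s ⟨i, h⟩ :=
  Equiv.Perm.extendDomain_apply_subtype (p := fun i : ℕ => i < n) s Fin.equivSubtype h

theorem extendPerm_of_le {n : ℕ} (s : Equiv.Perm (Fin n)) {i : ℕ} (h : n ≤ i) :
    extendPerm n s i = i :=
  Equiv.Perm.extendDomain_apply_not_subtype (p := fun i : ℕ => i < n) s Fin.equivSubtype
    (not_lt.mpr h)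

/-- Extension of `x ∈ S_n(G)` to `ℕ` by trivial entries and fixed points. -/
def extendNat (n : ℕ) : SG G n →* Wreath G ℕ where
  toFun x := ⟨fun i => if h : i < n then x.left ⟨i, h⟩ else 1, extendPerm n x.right⟩
  map_one' := by
    apply wreath_ext <;> intro i
    · simp
    · exact congrArg (fun s : Equiv.Perm ℕ => s i)
        (Equiv.Perm.extendDomain_one (p := fun i : ℕ => i < n) Fin.equivSubtype)
  map_mul' x y := by
    have hinv : (extendPerm n x.right)⁻¹ = extendPerm n x.right⁻¹ :=
      Equiv.Perm.extendDomain_inv x.right Fin.equivSubtype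
    apply wreath_ext <;> intro i
    · rw [mul_left_apply]
      simp only [hinv]
      rcases lt_or_ge i n with h | h
      · simp only [extendPerm_of_lt _ h, h, Fin.is_lt, dite_true, Fin.eta]
        rfl
      · simp only [extendPerm_of_le _ h, not_lt.mpr h, dite_false, one_mul]
    · exact congrArg (fun s : Equiv.Perm ℕ => s i)
        (Equiv.Perm.extendDomain_mul (p := fun i : ℕ => i < n) Fin.equivSubtype
          x.right y.right).symm

theorem extendNat_left (n : ℕ) (x : SG G n) (i : Fin n) : (extendNat n x).left i = x.left i := by
  simp [extendNat]

theorem extendNat_right (n : ℕ) (x : SG G n) (i : Fin n) :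
    (extendNat n x).right i = x.right i :=
  extendPerm_of_lt x.right i.2

theorem extendNat_left_of_le {n : ℕ} (x : SG G n) {i : ℕ} (h : n ≤ i) :
    (extendNat n x).left i = 1 := by
  simp [extendNat, h]

theorem extendNat_right_of_le {n : ℕ} (x : SG G n) {i : ℕ} (h : n ≤ i) :
    (extendNat n x).right i = i :=
  extendPerm_of_le x.right h

theorem extendNat_injective (n : ℕ) : Function.Injective (extendNat (G := G) n) := by
  intro x y h
  apply wreath_ext <;> intro i
  · rw [← extendNat_left, ← extendNat_left, h]
  · apply Fin.ext
    rw [← extendNat_right, ← extendNat_right, h]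

/-- The canonical inclusion `i_n : S_n(G) → S_∞(G)`. -/
def incl (n : ℕ) : SG G n →* SInf G :=
  (extendNat n).codRestrict (SInf G) fun x =>
    ⟨(Set.finite_lt_nat n).subset fun i hi => by
        by_contra h
        exact hi (extendNat_left_of_le x (by simpa using h)),
      (Set.finite_lt_nat n).subset fun i hi => by
        by_contra h
        exact hi (extendNat_right_of_le x (by simpa using h))⟩

theorem coe_incl (n : ℕ) (x : SG G n) : (incl n x : Wreath G ℕ) = extendNat n x := rfl

theorem incl_injective (n : ℕ) : Function.Injective (incl (G := G) n) := fun x y h =>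
  extendNat_injective n (by rw [← coe_incl, ← coe_incl, h])

theorem mem_range_incl {n : ℕ} {w : SInf G} : w ∈ Set.range (incl (G := G) n) ↔
    ∀ i, n ≤ i → w.1.left i = 1 ∧ w.1.right i = i := by
  constructor
  · rintro ⟨v, rfl⟩ i hi
    exact ⟨extendNat_left_of_le v hi, extendNat_right_of_le v hi⟩
  · intro h
    have key : ∀ i, i < n ↔ w.1.right i < n := by
      intro i
      constructor
      · intro hi
        by_contra hcon
        have h1 := (h _ (not_lt.mp hcon)).2
        have h2 := w.1.right.injective h1
        omega
      · intro hi
        by_contra hcon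
        rw [(h _ (not_lt.mp hcon)).2] at hi
        exact hcon hi
    refine ⟨⟨fun i => w.1.left i,
      Fin.equivSubtype.permCongr.symm (w.1.right.subtypePerm (p := fun i : ℕ => i < n)
        fun i => (key i).symm)⟩, ?_⟩
    apply Subtype.ext
    rw [coe_incl]
    apply wreath_ext <;> intro i <;> rcases lt_or_ge i n with hi | hi
    · exact extendNat_left n _ ⟨i, hi⟩
    · rw [extendNat_left_of_le _ hi, (h i hi).1]
    · exact extendNat_right n _ ⟨i, hi⟩
    · rw [extendNat_right_of_le _ hi, (h i hi).2]

/-- `W ∈ S_n(G) × S_n(G)`, for `W ∈ S_∞(G) × S_∞(G)`. -/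
def InStage (n : ℕ) (W : SInf G × SInf G) : Prop :=
  W.1 ∈ Set.range (incl (G := G) n) ∧ W.2 ∈ Set.range (incl (G := G) n)

theorem InStage.mono {m n : ℕ} (hmn : m ≤ n) {W : SInf G × SInf G} (h : InStage m W) :
    InStage n W :=
  ⟨mem_range_incl.2 fun i hi => mem_range_incl.1 h.1 i (hmn.trans hi),
    mem_range_incl.2 fun i hi => mem_range_incl.1 h.2 i (hmn.trans hi)⟩

theorem exists_mem_range (w : SInf G) : ∃ n, w ∈ Set.range (incl (G := G) n) := by
  obtain ⟨N, hN⟩ := (w.2.1.union w.2.2).bddAbove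
  refine ⟨N + 1, mem_range_incl.2 fun i hi => ?_⟩
  by_contra hcon
  have : i ≤ N := hN (by
    rw [not_and_or] at hcon
    exact hcon)
  omega

theorem exists_inStage (W : SInf G × SInf G) : ∃ n, InStage n W := by
  obtain ⟨a, ha⟩ := exists_mem_range W.1
  obtain ⟨b, hb⟩ := exists_mem_range W.2
  exact ⟨max a b, mem_range_incl.2 fun i hi => mem_range_incl.1 ha i ((le_max_left _ _).trans hi),
    mem_range_incl.2 fun i hi => mem_range_incl.1 hb i ((le_max_right _ _).trans hi)⟩

/-! ### Coloured cycles -/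

/-- The cycles of `s`, where `x = (g, s)`; fixed points count as cycles of length one. -/
abbrev Cycles {n : ℕ} (x : SG G n) : Type := Quotient (Equiv.Perm.SameCycle.setoid x.right)

/-- `walk x i k = g_{i_k} ⋯ g_{i_2} g_{i_1}`, where `x = (g, s)`, `i_1 = i` and
`i_{j+1} = s(i_j)`. -/
def walk {n : ℕ} (x : SG G n) (i : Fin n) : ℕ → G
  | 0 => 1
  | k + 1 => x.left ((x.right ^ k) i) * walk x i k

/-- The product `g_{i_r} ⋯ g_{i_1}` along the cycle `(i_1 i_2 … i_r)` through `i = i_1`. -/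
def cycleProd {n : ℕ} (x : SG G n) (i : Fin n) : G :=
  walk x i (Function.minimalPeriod x.right i)

theorem walk_succ' {n : ℕ} (x : SG G n) (i : Fin n) (k : ℕ) :
    walk x i (k + 1) = walk x (x.right i) k * x.left i := by
  induction k with
  | zero => simp [walk]
  | succ k ih =>
    rw [walk, ih, walk, mul_assoc, pow_succ, Equiv.Perm.mul_apply]

theorem isConj_cycleProd {n : ℕ} (x : SG G n) (i : Fin n) :
    IsConj (cycleProd x i) (cycleProd x (x.right i)) := by
  have hper : i ∈ Function.periodicPts x.right :=
    (Function.Injective.mem_periodicPts x.right.injective i)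
  have h1 : Function.minimalPeriod x.right (x.right i) = Function.minimalPeriod x.right i :=
    Function.minimalPeriod_apply hper
  obtain ⟨r, hr⟩ : ∃ r, Function.minimalPeriod x.right i = r + 1 :=
    Nat.exists_eq_succ_of_ne_zero (Function.minimalPeriod_pos_of_mem_periodicPts hper).ne'
  have h2 : (x.right ^ r) (x.right i) = i := by
    rw [← Equiv.Perm.mul_apply, ← pow_succ, ← hr, ← Equiv.Perm.iterate_eq_pow]
    exact Function.iterate_minimalPeriod
  rw [cycleProd, cycleProd, h1, hr, walk_succ', walk, h2, isConj_iff]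
  exact ⟨x.left i, by group⟩

/-- The colour of a cycle: the conjugacy class of the product along it. -/
def color {n : ℕ} (x : SG G n) : Cycles x → ConjClasses G :=
  Quotient.lift (fun i => ConjClasses.mk (cycleProd x i)) (by
    intro i j hij
    obtain ⟨k, rfl⟩ := Equiv.Perm.SameCycle.exists_nat_pow_eq hij
    induction k with
    | zero => rfl
    | succ k ih =>
      rw [pow_succ', Equiv.Perm.mul_apply]
      exact (ih ⟨k, by simp⟩).trans
        (ConjClasses.mk_eq_mk_iff_isConj.2 (isConj_cycleProd x _)))

/-- `[x](c)`, the number of cycles of `x` of colour `c`. -/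
def cycleCount {n : ℕ} (x : SG G n) (c : ConjClasses G) : ℕ :=
  Nat.card {q : Cycles x // color x q = c}

/-! ### The canonical projection -/

/-- Removal of the last point from the cycle of `s` that contains it. -/
def projPerm {n : ℕ} (s : Equiv.Perm (Fin (n + 1))) : Equiv.Perm (Fin n) :=
  Equiv.removeNone (finSuccEquivLast.permCongr s)

theorem castSucc_projPerm {n : ℕ} (s : Equiv.Perm (Fin (n + 1))) (i : Fin n) :
    (projPerm s i).castSucc =
      if s i.castSucc = Fin.last n then s (Fin.last n) else s i.castSucc := by
  have hsome : ∀ j : Fin n, j.castSucc = finSuccEquivLast.symm (some j) := fun j => by simp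
  rw [hsome]
  split_ifs with h
  · have h0 : (finSuccEquivLast.permCongr s) (some i) = none := by
      simp [Equiv.permCongr_apply, h]
    rw [projPerm, Equiv.removeNone_none _ h0]
    simp [Equiv.permCongr_apply]
  · obtain ⟨j, hj⟩ := Fin.exists_castSucc_eq.2 h
    have h0 : (finSuccEquivLast.permCongr s) (some i) = some j := by
      simp [Equiv.permCongr_apply, ← hj]
    rw [projPerm, Equiv.removeNone_some _ ⟨j, h0⟩, h0]
    simp [hj]

/-- The canonical projection `p_{n,n+1} : S_{n+1}(G) → S_n(G)`: the last point is removed from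
its cycle `⋯ → i_m → n+1 → i_{m+1} → ⋯`, and the entry `g_{i_{m+1}}` is replaced by
`g_{i_{m+1}} g_{n+1}`; if `n+1` is a fixed point then its entry is dropped. -/
def proj (n : ℕ) (x : SG G (n + 1)) : SG G n :=
  ⟨fun j => if x.right (Fin.last n) = j.castSucc then x.left j.castSucc * x.left (Fin.last n)
      else x.left j.castSucc,
    projPerm x.right⟩

/-- Coordinates of an element of `S_n(G)` regarded as an element of `S_{n+1}(G)`. -/
theorem incl_succ_eq {n : ℕ} {v : SG G n} {v' : SG G (n + 1)} (h : incl (n + 1) v' = incl n v) :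
    (∀ i : Fin n, v'.left i.castSucc = v.left i) ∧ v'.left (Fin.last n) = 1 ∧
      (∀ i : Fin n, v'.right i.castSucc = (v.right i).castSucc) ∧
      v'.right (Fin.last n) = Fin.last n := by
  have h' : extendNat (n + 1) v' = extendNat n v := congrArg Subtype.val h
  refine ⟨fun i => ?_, ?_, fun i => ?_, ?_⟩
  · rw [← extendNat_left, h', ← extendNat_left]; rfl
  · rw [← extendNat_left, h']
    exact extendNat_left_of_le v (by simp)
  · apply Fin.ext
    rw [← extendNat_right, h', Fin.val_castSucc, Fin.val_castSucc, extendNat_right]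
  · apply Fin.ext
    rw [← extendNat_right, h']
    exact extendNat_right_of_le v (by simp)

/-- Compatibility of the projection with multiplication on the left by `S_n(G)`. -/
theorem proj_mul_left {n : ℕ} {v : SG G n} {v' : SG G (n + 1)} (h : incl (n + 1) v' = incl n v)
    (x : SG G (n + 1)) : proj n (v' * x) = v * proj n x := by
  obtain ⟨f1, f2, f3, f4⟩ := incl_succ_eq h
  have g3 : ∀ j : Fin n, v'.right⁻¹ j.castSucc = (v.right⁻¹ j).castSucc := fun j => by
    rw [Equiv.Perm.inv_eq_iff_eq, f3]; simp
  have g4 : v'.right⁻¹ (Fin.last n) = Fin.last n := by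
    rw [Equiv.Perm.inv_eq_iff_eq, f4]
  have hlast : ∀ k, v'.right k = Fin.last n ↔ k = Fin.last n := fun k => by
    rw [← Equiv.Perm.eq_inv_iff_eq, g4]
  apply wreath_ext <;> intro j
  · rw [mul_left_apply]
    have hc : (v' * x).right (Fin.last n) = j.castSucc ↔
        x.right (Fin.last n) = (v.right⁻¹ j).castSucc := by
      rw [← g3, Equiv.Perm.eq_inv_iff_eq]; rfl
    change (if _ then (v' * x).left j.castSucc * (v' * x).left (Fin.last n)
      else (v' * x).left j.castSucc) = v.left j * (if _ then _ else _)
    simp only [mul_left_apply, g3, g4, f1, f2, one_mul, hc]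
    split_ifs
    · rw [mul_assoc]
    · rfl
  · apply Fin.castSucc_injective
    change (projPerm (v'.right * x.right) j).castSucc = (v.right (projPerm x.right j)).castSucc
    rw [castSucc_projPerm, ← f3, castSucc_projPerm]
    simp only [Equiv.Perm.mul_apply, hlast]
    split_ifs <;> rfl

theorem proj_mul_right {n : ℕ} {v : SG G n} {v' : SG G (n + 1)} (h : incl (n + 1) v' = incl n v)
    (x : SG G (n + 1)) : proj n (x * v') = proj n x * v := by
  obtain ⟨f1, f2, f3, f4⟩ := incl_succ_eq h
  apply wreath_ext <;> intro j
  · rw [mul_left_apply]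
    have hc : (x * v').right (Fin.last n) = j.castSucc ↔
        x.right (Fin.last n) = j.castSucc := by
      change x.right (v'.right (Fin.last n)) = _ ↔ _
      rw [f4]
    obtain ⟨i, hi⟩ : ∃ i, projPerm x.right i = j := ⟨(projPerm x.right).symm j, by simp⟩
    have hi' : (proj n x).right⁻¹ j = i := by
      rw [Equiv.Perm.inv_eq_iff_eq]; exact hi.symm
    have hp := castSucc_projPerm x.right i
    rw [hi] at hp
    rw [hi']
    change (if _ then (x * v').left j.castSucc * (x * v').left (Fin.last n)
      else (x * v').left j.castSucc) =
      (if x.right (Fin.last n) = j.castSucc then x.left j.castSucc * x.left (Fin.last n)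
        else x.left j.castSucc) * v.left i
    simp only [mul_left_apply, hc]
    by_cases hl : x.right (Fin.last n) = j.castSucc
    · have hil : x.right i.castSucc = Fin.last n := by
        by_contra hne
        rw [if_neg hne, ← hl] at hp
        exact absurd (x.right.injective hp).symm (Fin.castSucc_lt_last i).ne
      have e1 : x.right⁻¹ j.castSucc = Fin.last n := by
        rw [Equiv.Perm.inv_eq_iff_eq, hl]
      have e2 : x.right⁻¹ (Fin.last n) = i.castSucc := by
        rw [Equiv.Perm.inv_eq_iff_eq, hil]
      rw [if_pos hl, if_pos hl, e1, e2, f1, f2]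
      group
    · have hil : x.right i.castSucc ≠ Fin.last n := by
        intro he
        rw [if_pos he] at hp
        exact hl hp.symm
      rw [if_neg hil] at hp
      have e1 : x.right⁻¹ j.castSucc = i.castSucc := by
        rw [Equiv.Perm.inv_eq_iff_eq, hp]
      rw [if_neg hl, if_neg hl, e1, f1]
  · apply Fin.castSucc_injective
    change (projPerm (x.right * v'.right) j).castSucc = (projPerm x.right (v.right j)).castSucc
    rw [castSucc_projPerm, castSucc_projPerm]
    simp only [Equiv.Perm.mul_apply, f3, f4]

/-! ### Virtual permutations and the two-sided action -/

variable (G) in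
/-- The space of `G`-virtual permutations, the projective limit of the sets `S_n(G)` under the
canonical projections. (The sequences start with their unique entry in the one-point set `S_0(G)`,
which carries no information.) -/
def Virtual : Type _ := {x : ∀ n, SG G n // ∀ n, proj n (x (n + 1)) = x n}

/-- The natural projection `p_n` from the virtual permutations to `S_n(G)`. -/
def Virtual.coord (n : ℕ) (x : Virtual G) : SG G n := x.1 n

theorem Virtual.exists_of_tail (N : ℕ) (Y : ∀ n, SG G n)
    (hY : ∀ n, N ≤ n → proj n (Y (n + 1)) = Y n) :
    ∃ y : Virtual G, ∀ n, N ≤ n → y.coord n = Y n := by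
  induction N generalizing Y with
  | zero => exact ⟨⟨Y, fun n => hY n n.zero_le⟩, fun n _ => rfl⟩
  | succ N ih =>
    obtain ⟨y, hy⟩ := ih (Function.update Y N (proj N (Y (N + 1)))) (by
      intro n hn
      rw [Function.update_of_ne (by omega : n + 1 ≠ N)]
      rcases hn.eq_or_lt with rfl | h
      · simp
      · rw [Function.update_of_ne (by omega : n ≠ N)]
        exact hY n h)
    refine ⟨y, fun n hn => ?_⟩
    rw [hy n (by omega), Function.update_of_ne (by omega : n ≠ N)]

theorem Virtual.exists_act (x : Virtual G) (W : SInf G × SInf G) :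
    ∃ y : Virtual G, ∀ (n : ℕ) (w₁ w₂ : SG G n), incl n w₁ = W.1 → incl n w₂ = W.2 →
      y.coord n = w₂⁻¹ * x.coord n * w₁ := by
  classical
  set N := Nat.find (exists_inStage W) with hN
  have hst : ∀ n, N ≤ n → InStage n W := fun n hn => (Nat.find_spec (exists_inStage W)).mono hn
  let a : ∀ n, SG G n := fun n => Function.invFun (incl n) W.1
  let b : ∀ n, SG G n := fun n => Function.invFun (incl n) W.2
  have ha : ∀ n, N ≤ n → incl n (a n) = W.1 := fun n hn => Function.invFun_eq (hst n hn).1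
  have hb : ∀ n, N ≤ n → incl n (b n) = W.2 := fun n hn => Function.invFun_eq (hst n hn).2
  obtain ⟨y, hy⟩ := Virtual.exists_of_tail N (fun n => (b n)⁻¹ * x.coord n * a n) (by
    intro n hn
    have h1 : incl (n + 1) (a (n + 1)) = incl n (a n) := by
      rw [ha _ (by omega), ha n hn]
    have h2 : incl (n + 1) (b (n + 1))⁻¹ = incl n (b n)⁻¹ := by
      rw [map_inv, map_inv, hb _ (by omega), hb n hn]
    rw [proj_mul_right h1, proj_mul_left h2]
    congr 2
    exact x.2 n)
  refine ⟨y, fun n w₁ w₂ h₁ h₂ => ?_⟩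
  have hn : N ≤ n := Nat.find_min' _ ⟨⟨w₁, h₁⟩, ⟨w₂, h₂⟩⟩
  rw [hy n hn]
  have e1 : a n = w₁ := incl_injective n ((ha n hn).trans h₁.symm)
  have e2 : b n = w₂ := incl_injective n ((hb n hn).trans h₂.symm)
  rw [e1, e2]

/-- The right action `x ↦ x W` of `S_∞(G) × S_∞(G)` on virtual permutations. It is determined by
`Virtual.coord_act`: for `W = (w₁, w₂) ∈ S_n(G) × S_n(G)`, `(x W)_n = w₂⁻¹ x_n w₁`. -/
def Virtual.act (W : SInf G × SInf G) (x : Virtual G) : Virtual G :=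
  (Virtual.exists_act x W).choose

theorem Virtual.coord_act (W : SInf G × SInf G) (x : Virtual G) (n : ℕ) (w₁ w₂ : SG G n)
    (h₁ : incl n w₁ = W.1) (h₂ : incl n w₂ = W.2) :
    (x.act W).coord n = w₂⁻¹ * x.coord n * w₁ :=
  (Virtual.exists_act x W).choose_spec n w₁ w₂ h₁ h₂

/-- The cocycle `C_c(x, W) = [p_n(x W)](c) - [p_n(x)](c)`, with `n` the least index such that
`W ∈ S_n(G) × S_n(G)`. -/
def cocycle (c : ConjClasses G) (x : Virtual G) (W : SInf G × SInf G) : ℤ :=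
  open Classical in
  let n := Nat.find (exists_inStage W)
  (cycleCount ((x.act W).coord n) c : ℤ) - cycleCount (x.coord n) c

/-- The product `∏_c (z(c) \overline{z(c)}) ^ C_c(x, W)` over the conjugacy classes of `G`; only
finitely many factors differ from `1`. -/
def density (z : ConjClasses G → ℂ) (x : Virtual G) (W : SInf G × SInf G) : ℝ :=
  ∏ᶠ c : ConjClasses G, (Complex.normSq (z c)) ^ cocycle c x W

end Group

/-! ### Topology and measures -/

section Measure

variable {G : Type*} [Group G] [TopologicalSpace G]

/-- The product topology on `S_n(G) = G^n × S_n`, with `S_n` discrete. -/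
instance instTopologicalSpaceSG (n : ℕ) : TopologicalSpace (SG G n) :=
  TopologicalSpace.induced (fun x => x.left) inferInstance ⊓
    TopologicalSpace.induced (fun x => x.right) ⊥

/-- The Borel sigma-algebra of `S_n(G)`. -/
instance instMeasurableSpaceSG (n : ℕ) : MeasurableSpace (SG G n) := borel _

instance instBorelSpaceSG (n : ℕ) : BorelSpace (SG G n) := ⟨rfl⟩

/-- The projective limit topology, i.e. the subspace topology of the product. -/
instance instTopologicalSpaceVirtual : TopologicalSpace (Virtual G) :=
  inferInstanceAs (TopologicalSpace {x : ∀ n, SG G n // ∀ n, proj n (x (n + 1)) = x n})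

/-- The Borel sigma-algebra of the space of virtual permutations. -/
instance instMeasurableSpaceVirtual : MeasurableSpace (Virtual G) := borel _

instance instBorelSpaceVirtual : BorelSpace (Virtual G) := ⟨rfl⟩

/-- Quasi-invariance under the action of `S_∞(G) × S_∞(G)`: every element acts measurably and
transforms the measure into an equivalent one. -/
def QuasiInvariant (μ : Measure (Virtual G)) : Prop :=
  ∀ W : SInf G × SInf G, Measurable (Virtual.act W) ∧
    μ.map (Virtual.act W) ≪ μ ∧ μ ≪ μ.map (Virtual.act W)

variable [IsTopologicalGroup G] [CompactSpace G]

variable (G) in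
/-- The normalized Haar measure of `G`. -/
def haarG [MeasurableSpace G] [BorelSpace G] : Measure G := Measure.haarMeasure ⊤

variable (G) in
/-- The `n`-fold product of the normalized Haar measure of `G`, as a measure on all Borel sets of
`G^n`. As `G` need not be second countable, there may be more of these than sets in the product
sigma-algebra, so the product is taken as the normalized Haar measure of `G^n`;
see `haarPow_pi` for the product formula. -/
def haarPow (n : ℕ) : @Measure (Fin n → G) (borel _) :=
  letI : MeasurableSpace (Fin n → G) := borel _
  haveI : BorelSpace (Fin n → G) := ⟨rfl⟩
  Measure.haarMeasure ⊤

theorem haarPow_pi [MeasurableSpace G] [BorelSpace G] (n : ℕ) (A : Fin n → Set G)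
    (hA : ∀ i, MeasurableSet (A i)) :
    @DFunLike.coe _ _ _ (@Measure.instFunLike (Fin n → G) (borel _)) (haarPow G n)
      (Set.univ.pi A) = ∏ i, haarG G (A i) := by
  let _ : MeasurableSpace (Fin n → G) := borel _
  have : BorelSpace (Fin n → G) := ⟨rfl⟩
  have hpow : haarPow G n = Measure.haarMeasure ⊤ := rfl
  have hG : haarG G = Measure.haarMeasure ⊤ := rfl
  have hp1 : haarPow G n Set.univ = 1 := by
    rw [hpow]; exact Measure.haarMeasure_self (K₀ := ⊤)
  have hG1 : haarG G Set.univ = 1 := by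
    rw [hG]; exact Measure.haarMeasure_self (K₀ := ⊤)
  have : IsFiniteMeasure (haarPow G n) := ⟨by rw [hp1]; exact ENNReal.one_lt_top⟩
  have : (haarPow G n).IsMulLeftInvariant := by rw [hpow]; infer_instance
  have : (haarG G).IsHaarMeasure := by rw [hG]; infer_instance
  have hev : ∀ i, Measurable fun g : Fin n → G => g i := fun i => (continuous_apply i).measurable
  have key : ∀ S : Finset (Fin n),
      haarPow G n {g | ∀ i ∈ S, g i ∈ A i} = ∏ i ∈ S, haarG G (A i) := by
    intro S
    induction S using Finset.induction_on with
    | empty => simpa using hp1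
    | insert k S hk ih =>
      set T : Set (Fin n → G) := {g | ∀ i ∈ S, g i ∈ A i} with hT
      have hTm : MeasurableSet T := by
        have : T = ⋂ i ∈ S, (fun g : Fin n → G => g i) ⁻¹' A i := by ext; simp [hT]
        rw [this]
        exact Finset.measurableSet_biInter _ fun i _ => hev i (hA i)
      set ρ : Measure G := ((haarPow G n).restrict T).map fun g => g k with hρ
      have hρa : ∀ B, MeasurableSet B →
          ρ B = haarPow G n ((fun g : Fin n → G => g k) ⁻¹' B ∩ T) := fun B hB => by
        rw [hρ, Measure.map_apply (hev k) hB, Measure.restrict_apply (hev k hB)]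
      have : IsFiniteMeasure ρ := by rw [hρ]; infer_instance
      have : ρ.IsMulLeftInvariant := by
        constructor
        intro a
        ext B hB
        rw [Measure.map_apply (continuous_const_mul a).measurable hB,
          hρa _ ((continuous_const_mul a).measurable hB), hρa B hB,
          ← measure_preimage_mul (haarPow G n) (Pi.mulSingle k a)
            ((fun g : Fin n → G => g k) ⁻¹' B ∩ T)]
        congr 1
        ext g
        have hS : ∀ i ∈ S, (Pi.mulSingle k a : Fin n → G) i = 1 := fun i hi =>
          Pi.mulSingle_eq_of_ne (show i ≠ k from fun h => hk (h ▸ hi)) _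
        simp only [hT, Set.mem_inter_iff, Set.mem_preimage, Set.mem_ofPred_eq, Pi.mul_apply,
          Pi.mulSingle_eq_same]
        refine and_congr_right fun _ => forall₂_congr fun i hi => ?_
        rw [hS i hi, one_mul]
      have hsm := Measure.isMulInvariant_eq_smul_of_compactSpace ρ (haarG G)
      have hc : ((Measure.haarScalarFactor ρ (haarG G) : NNReal) : ENNReal) =
          ∏ i ∈ S, haarG G (A i) := by
        have h1 : ρ Set.univ = ∏ i ∈ S, haarG G (A i) := by
          rw [hρa _ MeasurableSet.univ, ← ih]; simp
        rw [← h1]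
        conv_rhs => rw [hsm]
        rw [Measure.smul_apply, hG1, ENNReal.smul_def, smul_eq_mul, mul_one]
      rw [Finset.prod_insert hk]
      have h2 : {g : Fin n → G | ∀ i ∈ insert k S, g i ∈ A i} =
          (fun g : Fin n → G => g k) ⁻¹' A k ∩ T := by
        ext g; simp [hT]
      rw [h2, ← hρa _ (hA k), hsm, Measure.smul_apply, ENNReal.smul_def, hc, smul_eq_mul, mul_comm]
  have := key Finset.univ
  rw [← this]
  congr 1
  ext g
  simp

variable (G) in
/-- The measure `μ_{S_n(G)}`, the product of the normalized Haar measures on the factors `G` and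
the uniform distribution on the permutations. -/
def wreathHaar (n : ℕ) : Measure (SG G n) :=
  ((n.factorial : ENNReal)⁻¹) • ∑ s : Equiv.Perm (Fin n),
    @Measure.map (Fin n → G) (SG G n) (borel _) _ (fun g => ⟨g, s⟩) (haarPow G n)

variable [MeasurableSpace G] [BorelSpace G]

/-- `I = ∫ |z(g)|² dμ_G(g)`. -/
def paramI (z : ConjClasses G → ℂ) : ℝ :=
  ∫ g, ‖z (ConjClasses.mk g)‖ ^ 2 ∂(haarG G)

/-- The density `P(x) = n! ∏_c (z(c) \overline{z(c)})^{[x](c)} / (I (I + 1) ⋯ (I + n - 1))`. -/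
def ewensDensity (n : ℕ) (z : ConjClasses G → ℂ) (x : SG G n) : ℝ :=
  n.factorial * (∏ᶠ c : ConjClasses G, (Complex.normSq (z c)) ^ cycleCount x c) /
    ∏ k ∈ Finset.range n, (paramI z + k)

/-- The Ewens measure on `S_n(G)`. -/
def ewens (n : ℕ) (z : ConjClasses G → ℂ) : Measure (SG G n) :=
  (wreathHaar G n).withDensity fun x => ENNReal.ofReal (ewensDensity n z x)

/-- `μ` is the projective limit of the Ewens measures on `S_n(G)`. -/
structure IsEwensLimit (z : ConjClasses G → ℂ) (μ : Measure (Virtual G)) : Prop where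
  isProbabilityMeasure : IsProbabilityMeasure μ
  map_coord : ∀ n, μ.map (Virtual.coord n) = ewens n z

end Measure

end WreathEwens

end

open WreathEwens

noncomputable section

namespace WreathEwens

/-! ### First return maps -/

/-! Everything rests on one combinatorial fact, `cycleCount_eq_proj`: an element `x` of $S_{n+1}(G)$
and its projection to $S_n(G)$ have the same coloured cycles, except that if $n+1$ is fixed by `x`,
it forms one extra cycle, coloured by its own entry. Hence the weight $w(x)=\prod_c|z(c)|^{2[x](c)}$
is the weight of the projection times a factor `lastWeight` that depends only on whether $n+1$ is
fixed and on $g_{n+1}$.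

Multiplication by elements of $S_n(G)$, on either side, commutes with the projection and leaves this
extra cycle alone. So the differences of cycle counts are the same at all admissible stages
(`cocycle_eq`), and the claimed density is the quotient $w((xW)_n)/w(x_n)$ at any of them
(`density_eq_div`).

The Ewens measures are consistent (`map_proj_ewens`): Haar measure on $S_{n+1}(G)$ weighted by
`lastWeight` projects to a left invariant measure on $S_n(G)$, hence to a multiple of Haar measure.
The multiple is the mean $(I+n)/(n+1)$ of `lastWeight`, which is the ratio of the two normalizing
constants.

The limit exists by weak compactness of the probability measures on the compact space of virtual
permutations, together with inner regularity, as `G` need not be metrizable. It is unique because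
cylinders generate the Borel sets. Finally, Haar measure on $S_n(G)$ is invariant on both sides, so
a translate of the Ewens measure there has a quotient of weights as density. These identities, for
all large $n$, lift to the limit (`IsEwensLimit.map_act_inv`). -/

theorem minimalPeriod_perm_pos {X : Type*} [Finite X] (s : Equiv.Perm X) (i : X) :
    0 < Function.minimalPeriod s i :=
  Function.minimalPeriod_pos_of_mem_periodicPts (s.injective.mem_periodicPts i)

/-- `τ` is the map induced by `σ` on the range of `e`, with return times `m`. -/
structure FirstReturn {X Y : Type*} (σ : Equiv.Perm X) (τ : Equiv.Perm Y) (e : Y → X)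
    (m : Y → ℕ) : Prop where
  injective : Function.Injective e
  pos : ∀ y, 0 < m y
  map_eq : ∀ y, (σ ^ m y) (e y) = e (τ y)
  notMem : ∀ y r, 0 < r → r < m y → (σ ^ r) (e y) ∉ Set.range e

/-- The time of the `k`-th return. -/
def returnTime {Y : Type*} (τ : Equiv.Perm Y) (m : Y → ℕ) (y : Y) : ℕ → ℕ
  | 0 => 0
  | k + 1 => returnTime τ m y k + m ((τ ^ k) y)

namespace FirstReturn

variable {X Y : Type*} {σ : Equiv.Perm X} {τ : Equiv.Perm Y} {e : Y → X} {m : Y → ℕ}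

theorem pow_returnTime (h : FirstReturn σ τ e m) (y : Y) (k : ℕ) :
    (σ ^ returnTime τ m y k) (e y) = e ((τ ^ k) y) := by
  induction k with
  | zero => rfl
  | succ k ih =>
    rw [returnTime, add_comm, pow_add, Equiv.Perm.mul_apply, ih, h.map_eq, pow_succ',
      Equiv.Perm.mul_apply]

theorem strictMono_returnTime (h : FirstReturn σ τ e m) (y : Y) :
    StrictMono (returnTime τ m y) :=
  strictMono_nat_of_lt_succ fun k => by
    rw [returnTime]; exact Nat.lt_add_of_pos_right (h.pos _)

/-- The time `q` lies between two consecutive return times, and strictly between them the orbit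
avoids the range of `e`. -/
theorem exists_eq_returnTime (h : FirstReturn σ τ e m) {y y' : Y} {q : ℕ}
    (hq : (σ ^ q) (e y) = e y') : ∃ k, returnTime τ m y k = q ∧ (τ ^ k) y = y' := by
  obtain ⟨k, hk, hk'⟩ : ∃ k, returnTime τ m y k ≤ q ∧ q < returnTime τ m y (k + 1) := by
    -- A strictly increasing sequence of naturals dominates its index, so `k = q` is large enough;
    -- the least such `k` gives the interval containing `q`.
    have hex : ∃ k, q < returnTime τ m y (k + 1) :=
      ⟨q, (h.strictMono_returnTime y).le_apply.trans_lt
        (h.strictMono_returnTime y q.lt_succ_self)⟩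
    classical
    refine ⟨Nat.find hex, ?_, Nat.find_spec hex⟩
    rcases hk : Nat.find hex with _ | k
    · exact Nat.zero_le _
    · exact not_lt.1 (Nat.find_min hex (by omega : k < Nat.find hex))
  obtain ⟨r, rfl⟩ := Nat.exists_eq_add_of_le hk
  rw [add_comm, pow_add, Equiv.Perm.mul_apply, h.pow_returnTime] at hq
  rw [returnTime] at hk'
  obtain rfl : r = 0 := by
    by_contra hr
    exact h.notMem _ r (Nat.pos_of_ne_zero hr) (by omega) ⟨y', hq.symm⟩
  exact ⟨k, rfl, h.injective hq⟩

/-- The orbit of `e y` can close up only at a return time, and it does so at the `k`-th one exactly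
when `τ ^ k` fixes `y`. -/
theorem minimalPeriod_eq [Finite X] [Finite Y] (h : FirstReturn σ τ e m) (y : Y) :
    Function.minimalPeriod σ (e y) = returnTime τ m y (Function.minimalPeriod τ y) := by
  have hper : (σ ^ Function.minimalPeriod σ (e y)) (e y) = e y := by
    rw [← Equiv.Perm.iterate_eq_pow]; exact Function.iterate_minimalPeriod
  obtain ⟨k, hk, hk'⟩ := h.exists_eq_returnTime hper
  apply le_antisymm
  · refine Function.IsPeriodicPt.minimalPeriod_le ?_ ?_
    · exact (h.strictMono_returnTime y) (minimalPeriod_perm_pos τ y)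
    · change σ^[_] _ = _
      rw [Equiv.Perm.iterate_eq_pow, h.pow_returnTime, ← Equiv.Perm.iterate_eq_pow,
        Function.iterate_minimalPeriod]
  · rw [← hk]
    apply (h.strictMono_returnTime y).monotone
    refine Function.IsPeriodicPt.minimalPeriod_le ?_ ?_
    · rcases Nat.eq_zero_or_pos k with rfl | hk0
      · exact absurd hk.symm (minimalPeriod_perm_pos σ (e y)).ne'
      · exact hk0
    · change τ^[_] _ = _
      rw [Equiv.Perm.iterate_eq_pow, hk']

theorem sameCycle_iff [Finite X] [Finite Y] (h : FirstReturn σ τ e m) {y y' : Y} :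
    σ.SameCycle (e y) (e y') ↔ τ.SameCycle y y' := by
  constructor
  · intro hs
    obtain ⟨q, hq⟩ := hs.exists_nat_pow_eq
    obtain ⟨k, -, hk⟩ := h.exists_eq_returnTime hq
    exact ⟨k, by simpa using hk⟩
  · intro hs
    obtain ⟨k, rfl⟩ := hs.exists_nat_pow_eq
    exact ⟨returnTime τ m y k, by simpa using h.pow_returnTime y k⟩

end FirstReturn

section Group

variable {G : Type*} [Group G]

/-! ### Cycle counts of projections -/

theorem walk_add {n : ℕ} (x : SG G n) (i : Fin n) (a b : ℕ) :
    walk x i (a + b) = walk x ((x.right ^ a) i) b * walk x i a := by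
  induction b with
  | zero => simp [walk]
  | succ b ih =>
    rw [← add_assoc, walk, ih, walk, mul_assoc, ← Equiv.Perm.mul_apply, ← pow_add, add_comm b a]

/-- The walk of `x` around a cycle splits at the return times into segments, and each segment
contributes one entry of `y`. -/
theorem FirstReturn.cycleProd_eq {k n : ℕ} {x : SG G n} {y : SG G k} {e : Fin k → Fin n}
    {m : Fin k → ℕ} (h : FirstReturn x.right y.right e m)
    (hw : ∀ i, walk x (e i) (m i) = y.left i) (i : Fin k) :
    cycleProd x (e i) = cycleProd y i := by
  rw [cycleProd, cycleProd, h.minimalPeriod_eq]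
  generalize Function.minimalPeriod y.right i = p
  induction p with
  | zero => rfl
  | succ p ih => rw [returnTime, walk_add, ih, h.pow_returnTime, hw, walk]

/-- The point of `{1, …, n+1}` at which the step of `x` corresponding to the step of `proj n x`
at `i` begins. -/
def stepStart {n : ℕ} (x : SG G (n + 1)) (i : Fin n) : Fin (n + 1) :=
  if x.right (Fin.last n) = i.castSucc then Fin.last n else i.castSucc

theorem stepStart_proj {n : ℕ} (x : SG G (n + 1)) (i : Fin n) :
    stepStart x ((proj n x).right i) = x.right i.castSucc := by
  have hp : ((proj n x).right i).castSucc = _ := castSucc_projPerm x.right i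
  rw [stepStart, hp]
  by_cases h : x.right i.castSucc = Fin.last n
  · simp [h]
  · have : x.right (Fin.last n) ≠ x.right i.castSucc :=
      fun hc => (Fin.castSucc_lt_last i).ne (x.right.injective hc).symm
    simp [h, this]

/-- The merged entry $g_{i_{m+1}}g_{n+1}$ is the product along two steps of `x` starting at $n+1$,
since later factors stand on the left. This is why the embedding sends $i_{m+1}$ to $n+1$ and not to
itself: the equality of cycle products is then exact, not only up to conjugation. -/
theorem firstReturn_proj {n : ℕ} (x : SG G (n + 1)) :
    FirstReturn x.right (proj n x).right (stepStart x)
      (fun i => if x.right (Fin.last n) = i.castSucc then 2 else 1) where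
  injective i j hij := by
    have hi := (Fin.castSucc_lt_last i).ne
    have hj := (Fin.castSucc_lt_last j).ne
    unfold stepStart at hij
    split_ifs at hij with h1 h2 h2
    · exact Fin.castSucc_injective _ (h1.symm.trans h2)
    · exact absurd hij.symm hj
    · exact absurd hij hi
    · exact Fin.castSucc_injective _ hij
  pos i := by split_ifs <;> norm_num
  map_eq i := by
    rw [stepStart_proj, stepStart]
    split_ifs with h
    · rw [pow_two, Equiv.Perm.mul_apply, h]
    · rw [pow_one]
  notMem i r hr hr' := by
    split_ifs at hr' with h
    · obtain rfl : r = 1 := by omega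
      rintro ⟨j, hj⟩
      rw [pow_one, stepStart, stepStart, if_pos h] at hj
      split_ifs at hj with h'
      · exact (Fin.castSucc_lt_last i).ne (h.symm.trans hj.symm)
      · exact h' hj.symm
    · omega

theorem cycleProd_stepStart {n : ℕ} (x : SG G (n + 1)) (i : Fin n) :
    cycleProd x (stepStart x i) = cycleProd (proj n x) i := by
  refine (firstReturn_proj x).cycleProd_eq (fun j => ?_) i
  change _ = if x.right (Fin.last n) = j.castSucc then x.left j.castSucc * x.left (Fin.last n)
      else x.left j.castSucc
  rw [stepStart]
  split_ifs with h
  · simp [walk, h]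
  · simp [walk]

/-- The map on cycles induced by `stepStart`. -/
def cyclesOfProj {n : ℕ} (x : SG G (n + 1)) : Cycles (proj n x) → Cycles x :=
  Quotient.map' (stepStart x) fun _ _ h => (firstReturn_proj x).sameCycle_iff.2 h

theorem cyclesOfProj_injective {n : ℕ} (x : SG G (n + 1)) :
    Function.Injective (cyclesOfProj x) := by
  intro a b
  induction a using Quotient.inductionOn
  induction b using Quotient.inductionOn
  intro h
  exact Quotient.sound ((firstReturn_proj x).sameCycle_iff.1 (Quotient.exact h))

theorem color_cyclesOfProj {n : ℕ} (x : SG G (n + 1)) (q : Cycles (proj n x)) :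
    color x (cyclesOfProj x q) = color (proj n x) q := by
  induction q using Quotient.inductionOn with
  | h i => exact congrArg ConjClasses.mk (cycleProd_stepStart x i)

/-- The only point outside the range of `stepStart` is the image of the last point, and it shares
its cycle with the last point, which is in the range. -/
theorem range_cyclesOfProj_of_ne {n : ℕ} {x : SG G (n + 1)}
    (h : x.right (Fin.last n) ≠ Fin.last n) : Set.range (cyclesOfProj x) = Set.univ := by
  refine Set.eq_univ_of_forall fun q => ?_
  induction q using Quotient.inductionOn with
  | h i =>
    obtain ⟨j, hj⟩ := Fin.exists_castSucc_eq.2 h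
    by_cases hi : ∃ k, stepStart x k = i
    · obtain ⟨k, rfl⟩ := hi
      exact ⟨Quotient.mk _ k, rfl⟩
    · refine ⟨Quotient.mk _ j, Quotient.sound ⟨1, ?_⟩⟩
      have e1 : stepStart x j = Fin.last n := if_pos hj.symm
      rw [zpow_one, e1]
      rcases Fin.eq_castSucc_or_eq_last i with ⟨k, rfl⟩ | rfl
      · by_contra hne
        exact hi ⟨k, if_neg hne⟩
      · exact absurd ⟨j, e1⟩ hi

theorem range_cyclesOfProj_of_eq {n : ℕ} {x : SG G (n + 1)}
    (h : x.right (Fin.last n) = Fin.last n) :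
    Set.range (cyclesOfProj x) = {Quotient.mk _ (Fin.last n)}ᶜ := by
  have hs : ∀ i, stepStart x i = i.castSucc := fun i =>
    if_neg (by rw [h]; exact (Fin.castSucc_lt_last i).ne')
  ext q
  induction q using Quotient.inductionOn with
  | h i =>
    rw [Set.mem_compl_iff, Set.mem_singleton_iff]
    constructor
    · rintro ⟨a, ha⟩ hq
      rw [hq] at ha
      induction a using Quotient.inductionOn with
      | h k =>
        have := (Quotient.exact ha : x.right.SameCycle (stepStart x k) (Fin.last n))
        rw [hs] at this
        obtain ⟨r, hr⟩ := this.symm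
        rw [Equiv.Perm.zpow_apply_eq_self_of_apply_eq_self h] at hr
        exact (Fin.castSucc_lt_last k).ne' hr
    · intro hq
      rcases Fin.eq_castSucc_or_eq_last i with ⟨k, rfl⟩ | rfl
      · exact ⟨Quotient.mk _ k, congrArg (Quotient.mk _) (hs k)⟩
      · exact absurd rfl hq

theorem color_last_of_eq {n : ℕ} {x : SG G (n + 1)} (h : x.right (Fin.last n) = Fin.last n) :
    color x (Quotient.mk _ (Fin.last n)) = ConjClasses.mk (x.left (Fin.last n)) := by
  have h1 : Function.minimalPeriod x.right (Fin.last n) = 1 :=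
    Function.minimalPeriod_eq_one_iff_isFixedPt.2 h
  change ConjClasses.mk (cycleProd x (Fin.last n)) = _
  rw [cycleProd, h1]
  simp [walk]

open Classical in
-- The induced map on cycles is injective and preserves colours; it misses nothing, or only the
-- cycle of the last point when that point is fixed.
theorem cycleCount_eq_proj {n : ℕ} (x : SG G (n + 1)) (c : ConjClasses G) :
    cycleCount x c = cycleCount (proj n x) c +
      if x.right (Fin.last n) = Fin.last n ∧ ConjClasses.mk (x.left (Fin.last n)) = c
        then 1 else 0 := by
  have hcount : ∀ {k : ℕ} (y : SG G k), cycleCount y c = {q | color y q = c}.ncard :=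
    fun y => rfl
  rw [hcount, hcount, ← Set.ncard_image_of_injective _ (cyclesOfProj_injective x)]
  have himage : cyclesOfProj x '' {q | color (proj n x) q = c} =
      Set.range (cyclesOfProj x) ∩ {q | color x q = c} := by
    ext q
    constructor
    · rintro ⟨a, ha, rfl⟩
      exact ⟨⟨a, rfl⟩, (color_cyclesOfProj x a).trans ha⟩
    · rintro ⟨⟨a, rfl⟩, ha⟩
      exact ⟨a, (color_cyclesOfProj x a).symm.trans ha, rfl⟩
  rw [himage]
  by_cases h : x.right (Fin.last n) = Fin.last n
  · rw [range_cyclesOfProj_of_eq h]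
    by_cases hc : ConjClasses.mk (x.left (Fin.last n)) = c
    · rw [if_pos ⟨h, hc⟩, Set.inter_comm, ← Set.sdiff_eq, Set.ncard_sdiff_singleton_add_one]
      exact (color_last_of_eq h).trans hc
    · rw [if_neg fun hh => hc hh.2, add_zero, Set.inter_comm, ← Set.sdiff_eq,
        Set.sdiff_singleton_eq_self]
      exact fun hh => hc ((color_last_of_eq h).symm.trans hh)
  · rw [range_cyclesOfProj_of_ne h, if_neg fun hh => h hh.1, add_zero, Set.univ_inter]

theorem finite_support_cycleCount {n : ℕ} (x : SG G n) :
    (Function.support (cycleCount x)).Finite := by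
  refine (Set.finite_range (color x)).subset fun c hc => ?_
  by_contra hcon
  apply hc
  have : IsEmpty {q : Cycles x // color x q = c} := ⟨fun q => hcon ⟨q.1, q.2⟩⟩
  exact Nat.card_of_isEmpty

/-! ### The weight of an element of the wreath product -/

/-- `∏_c |z(c)|^{2 [x](c)}`. -/
def weight (z : ConjClasses G → ℂ) {n : ℕ} (x : SG G n) : ℝ :=
  ∏ᶠ c : ConjClasses G, (Complex.normSq (z c)) ^ cycleCount x c

/-- The factor that the last point contributes to the weight if it is a fixed point. -/
def lastWeight (z : ConjClasses G → ℂ) {n : ℕ} (x : SG G (n + 1)) : ℝ :=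
  if x.right (Fin.last n) = Fin.last n then
    Complex.normSq (z (ConjClasses.mk (x.left (Fin.last n)))) else 1

theorem finite_mulSupport_pow {z : ConjClasses G → ℂ} {n : ℕ} (x : SG G n) :
    (Function.mulSupport fun c => (Complex.normSq (z c)) ^ cycleCount x c).Finite := by
  refine (finite_support_cycleCount x).subset fun c hc h => hc ?_
  simp [h]

theorem weight_eq_proj (z : ConjClasses G → ℂ) {n : ℕ} (x : SG G (n + 1)) :
    weight z x = weight z (proj n x) * lastWeight z x := by
  classical
  rw [weight]
  simp only [cycleCount_eq_proj x, pow_add]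
  have heq : ∀ c, (Complex.normSq (z c)) ^ (if x.right (Fin.last n) = Fin.last n ∧
      ConjClasses.mk (x.left (Fin.last n)) = c then 1 else 0) =
      if c = ConjClasses.mk (x.left (Fin.last n)) then lastWeight z x else 1 := by
    intro c
    unfold lastWeight
    by_cases h : x.right (Fin.last n) = Fin.last n <;>
      by_cases hc : c = ConjClasses.mk (x.left (Fin.last n)) <;>
      simp [h, hc, eq_comm (b := c)]
  rw [finprod_mul_distrib (finite_mulSupport_pow _)]
  · simp only [heq]
    rw [finprod_eq_single (fun c => if c = _ then lastWeight z x else 1)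
      (ConjClasses.mk (x.left (Fin.last n))) fun c hc => if_neg hc, if_pos rfl, weight]
  · simp only [heq]
    refine (Set.finite_singleton (ConjClasses.mk (x.left (Fin.last n)))).subset fun c hc => ?_
    by_contra hne
    exact hc (if_neg hne)

theorem weight_zero (z : ConjClasses G → ℂ) (x : SG G 0) : weight z x = 1 := by
  rw [weight]
  refine finprod_eq_one_of_forall_eq_one fun c => ?_
  have : IsEmpty (Cycles x) := ⟨fun q => Quotient.inductionOn q fun i => i.elim0⟩
  have : cycleCount x c = 0 := Nat.card_of_isEmpty
  simp [this]

theorem lastWeight_pos {z : ConjClasses G → ℂ} (hz0 : ∀ c, z c ≠ 0) {n : ℕ} (x : SG G (n + 1)) :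
    0 < lastWeight z x := by
  unfold lastWeight
  split_ifs
  · exact Complex.normSq_pos.2 (hz0 _)
  · exact one_pos

theorem weight_pos {z : ConjClasses G → ℂ} (hz0 : ∀ c, z c ≠ 0) {n : ℕ} (x : SG G n) :
    0 < weight z x := by
  induction n with
  | zero => rw [weight_zero]; exact one_pos
  | succ n ih => rw [weight_eq_proj]; exact mul_pos (ih _) (lastWeight_pos hz0 x)

/-- This invariance is what makes the projection of the weighted Haar measure left invariant in
`map_proj_ewens`. -/
theorem lastWeight_mul_left {z : ConjClasses G → ℂ} {n : ℕ} {v : SG G n} {v' : SG G (n + 1)}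
    (h : incl (n + 1) v' = incl n v) (x : SG G (n + 1)) :
    lastWeight z (v' * x) = lastWeight z x := by
  obtain ⟨-, h1, -, h2⟩ := incl_succ_eq h
  have h3 : v'.right⁻¹ (Fin.last n) = Fin.last n := by rw [Equiv.Perm.inv_eq_iff_eq, h2]
  have hr : (v' * x).right (Fin.last n) = Fin.last n ↔ x.right (Fin.last n) = Fin.last n := by
    change v'.right (x.right (Fin.last n)) = _ ↔ _
    rw [← Equiv.Perm.eq_inv_iff_eq, h3]
  simp only [lastWeight, hr]
  rw [mul_left_apply, h3, h1, one_mul]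

theorem exists_incl_succ_eq {n : ℕ} (v : SG G n) :
    ∃ v' : SG G (n + 1), incl (n + 1) v' = incl n v :=
  mem_range_incl.2 fun i hi => mem_range_incl.1 ⟨v, rfl⟩ i (n.le_succ.trans hi)

/-! ### The cocycle -/

/-- Multiplication by elements supported on the first `n` points changes neither whether the last
point is fixed nor, if it is, its entry. The corrections in `cycleCount_eq_proj` therefore cancel.
-/
theorem cycleCount_sub_eq_succ {n : ℕ} {v w : SG G n} {v' w' : SG G (n + 1)}
    (hv : incl (n + 1) v' = incl n v) (hw : incl (n + 1) w' = incl n w) (x : SG G (n + 1))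
    (c : ConjClasses G) :
    (cycleCount (v' * x * w') c : ℤ) - cycleCount x c =
      cycleCount (v * proj n x * w) c - cycleCount (proj n x) c := by
  classical
  obtain ⟨-, v1, -, v2⟩ := incl_succ_eq hv
  obtain ⟨-, w1, -, w2⟩ := incl_succ_eq hw
  have v3 : v'.right⁻¹ (Fin.last n) = Fin.last n := by rw [Equiv.Perm.inv_eq_iff_eq, v2]
  have hr : (v' * x * w').right (Fin.last n) = Fin.last n ↔
      x.right (Fin.last n) = Fin.last n := by
    change v'.right (x.right (w'.right (Fin.last n))) = _ ↔ _
    rw [w2, ← Equiv.Perm.eq_inv_iff_eq, v3]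
  have hl : x.right (Fin.last n) = Fin.last n →
      (v' * x * w').left (Fin.last n) = x.left (Fin.last n) := by
    intro h
    have h' : (v' * x).right⁻¹ (Fin.last n) = Fin.last n := by
      rw [Equiv.Perm.inv_eq_iff_eq]
      change _ = v'.right (x.right (Fin.last n))
      rw [h, v2]
    rw [mul_left_apply, mul_left_apply, h', v3, v1, w1, one_mul, mul_one]
  have hif : (if (v' * x * w').right (Fin.last n) = Fin.last n ∧
      ConjClasses.mk ((v' * x * w').left (Fin.last n)) = c then 1 else 0) =
      if x.right (Fin.last n) = Fin.last n ∧ ConjClasses.mk (x.left (Fin.last n)) = c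
        then 1 else 0 := by
    refine if_congr ?_ rfl rfl
    rw [hr]
    exact and_congr_right fun h => by rw [hl h]
  rw [cycleCount_eq_proj (v' * x * w'), cycleCount_eq_proj x, hif, proj_mul_right hw,
    proj_mul_left hv]
  push_cast
  ring

theorem cycleCount_act_sub_eq {m n : ℕ} (hmn : m ≤ n) {W : SInf G × SInf G} (hW : InStage m W)
    (x : Virtual G) (c : ConjClasses G) :
    (cycleCount ((x.act W).coord n) c : ℤ) - cycleCount (x.coord n) c =
      cycleCount ((x.act W).coord m) c - cycleCount (x.coord m) c := by
  induction n, hmn using Nat.le_induction with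
  | base => rfl
  | succ n hn ih =>
    rw [← ih]
    obtain ⟨⟨a, ha⟩, ⟨b, hb⟩⟩ := hW.mono hn
    obtain ⟨⟨a', ha'⟩, ⟨b', hb'⟩⟩ := hW.mono (hn.trans n.le_succ)
    rw [Virtual.coord_act W x _ a' b' ha' hb', Virtual.coord_act W x _ a b ha hb]
    have hx : x.coord n = proj n (x.coord (n + 1)) := (x.2 n).symm
    rw [hx]
    refine cycleCount_sub_eq_succ ?_ (ha'.trans ha.symm) _ c
    rw [map_inv, map_inv, hb, hb']

theorem cocycle_eq {W : SInf G × SInf G} {n : ℕ} (hW : InStage n W) (x : Virtual G)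
    (c : ConjClasses G) :
    cocycle c x W = (cycleCount ((x.act W).coord n) c : ℤ) - cycleCount (x.coord n) c := by
  classical
  exact (cycleCount_act_sub_eq (Nat.find_min' _ hW) (Nat.find_spec (exists_inStage W)) x c).symm

/-- This reduces the density to a function of one coordinate, from which its positivity, continuity
and role as a Radon–Nikodym derivative follow. -/
theorem density_eq_div {z : ConjClasses G → ℂ} (hz0 : ∀ c, z c ≠ 0) {W : SInf G × SInf G} {n : ℕ}
    (hW : InStage n W) (x : Virtual G) :
    density z x W = weight z ((x.act W).coord n) / weight z (x.coord n) := by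
  rw [density, weight, weight, ← finprod_div_distrib (finite_mulSupport_pow _)
    (finite_mulSupport_pow _)]
  refine finprod_congr fun c => ?_
  rw [cocycle_eq hW, zpow_sub₀ (Complex.normSq_pos.2 (hz0 c)).ne', zpow_natCast, zpow_natCast]

theorem density_pos {z : ConjClasses G → ℂ} (hz0 : ∀ c, z c ≠ 0) (x : Virtual G)
    (W : SInf G × SInf G) : 0 < density z x W := by
  obtain ⟨n, hn⟩ := exists_inStage W
  rw [density_eq_div hz0 hn]
  exact div_pos (weight_pos hz0 _) (weight_pos hz0 _)

/-! ### Coordinates of virtual permutations -/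

theorem Virtual.proj_coord (n : ℕ) (x : Virtual G) : proj n (x.coord (n + 1)) = x.coord n := x.2 n

theorem Virtual.ext_of_le {x y : Virtual G} (N : ℕ) (h : ∀ n, N ≤ n → x.coord n = y.coord n) :
    x = y := by
  have key : ∀ k m, N ≤ m + k → x.coord m = y.coord m := by
    intro k
    induction k with
    | zero => exact h
    | succ k ih =>
      intro m hm
      rw [← Virtual.proj_coord m, ← Virtual.proj_coord m, ih (m + 1) (by omega)]
  exact Subtype.ext (funext fun n => key N n (Nat.le_add_left _ _))

theorem Virtual.act_act_inv (W : SInf G × SInf G) (x : Virtual G) :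
    (x.act W).act W⁻¹ = x := by
  obtain ⟨N, hN⟩ := exists_inStage W
  refine Virtual.ext_of_le N fun n hn => ?_
  obtain ⟨⟨a, ha⟩, ⟨b, hb⟩⟩ := hN.mono hn
  rw [Virtual.coord_act W⁻¹ _ n a⁻¹ b⁻¹ (by rw [map_inv, ha]; rfl) (by rw [map_inv, hb]; rfl),
    Virtual.coord_act W x n a b ha hb]
  group

theorem Virtual.act_inv_act (W : SInf G × SInf G) (x : Virtual G) :
    (x.act W⁻¹).act W = x := by
  simpa using Virtual.act_act_inv W⁻¹ x

/-- Images of Borel sets thereby become preimages under a continuous map. -/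
theorem Virtual.image_act (W : SInf G × SInf G) (V : Set (Virtual G)) :
    Virtual.act W '' V = Virtual.act W⁻¹ ⁻¹' V :=
  congrFun (Set.image_eq_preimage_of_inverse (Virtual.act_act_inv W) (Virtual.act_inv_act W)) V

/-! ### The inclusion of successive wreath products -/

/-- The inclusion of `S_n(G)` in `S_{n+1}(G)`. -/
def lift {n : ℕ} (y : SG G n) : SG G (n + 1) :=
  ⟨Fin.snoc (α := fun _ => G) y.left 1, finSuccEquivLast.symm.permCongr y.right.optionCongr⟩

theorem proj_lift {n : ℕ} (y : SG G n) : proj n (lift y) = y := by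
  have h1 : (lift y).right (Fin.last n) = Fin.last n := by
    simp [lift, Equiv.permCongr_apply]
  have h2 : ∀ i : Fin n, (lift y).right i.castSucc = (y.right i).castSucc := fun i => by
    simp [lift, Equiv.permCongr_apply]
  apply wreath_ext <;> intro i
  · change (if _ then _ else _) = _
    rw [h1, if_neg (Fin.castSucc_lt_last i).ne']
    simp [lift]
  · apply Fin.castSucc_injective
    change (projPerm (lift y).right i).castSucc = _
    rw [castSucc_projPerm, h2, if_neg (Fin.castSucc_lt_last _).ne]

end Group

/-! ### Topology of the wreath products and of their projective limit -/

section Topology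

open Topology

/-- Used with `r` the permutation component: formulas on the wreath product need only be continuous
for each fixed permutation. -/
theorem continuous_of_isLocallyConstant {X Y α : Type*} [TopologicalSpace X] [TopologicalSpace Y]
    {r : X → α} (hr : IsLocallyConstant r) {F : α → X → Y} (hF : ∀ a, Continuous (F a)) :
    Continuous fun x => F (r x) x := by
  rw [continuous_iff_continuousAt]
  intro x
  refine ((hF (r x)).continuousAt).congr ?_
  filter_upwards [hr.eventually_eq x] with y hy
  rw [hy]

variable {G : Type*} [Group G] [TopologicalSpace G]

theorem continuous_left {n : ℕ} : Continuous fun x : SG G n => x.left :=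
  continuous_iff_le_induced.2 inf_le_left

theorem isLocallyConstant_right {n : ℕ} : IsLocallyConstant fun x : SG G n => x.right := by
  let _ : TopologicalSpace (Equiv.Perm (Fin n)) := ⊥
  have : DiscreteTopology (Equiv.Perm (Fin n)) := ⟨rfl⟩
  exact (IsLocallyConstant.iff_continuous _).2 (continuous_iff_le_induced.2 inf_le_right)

theorem continuous_SG_iff {X : Type*} [TopologicalSpace X] {n : ℕ} {f : X → SG G n} :
    Continuous f ↔ (∀ i, Continuous fun x => (f x).left i) ∧
      IsLocallyConstant fun x => (f x).right := by
  constructor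
  · intro hf
    exact ⟨fun i => (continuous_apply i).comp (continuous_left.comp hf),
      isLocallyConstant_right.comp_continuous hf⟩
  · rintro ⟨h1, h2⟩
    refine continuous_inf_rng.2 ⟨continuous_induced_rng.2 (continuous_pi h1),
      continuous_induced_rng.2 ?_⟩
    let _ : TopologicalSpace (Equiv.Perm (Fin n)) := ⊥
    exact h2.continuous

theorem continuous_mk_right {n : ℕ} (s : Equiv.Perm (Fin n)) :
    Continuous fun g : Fin n → G => (⟨g, s⟩ : SG G n) :=
  continuous_SG_iff.2 ⟨continuous_apply, IsLocallyConstant.const s⟩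

instance instCompactSpaceSG [CompactSpace G] (n : ℕ) : CompactSpace (SG G n) := by
  constructor
  have h : (Set.univ : Set (SG G n)) =
      ⋃ s : Equiv.Perm (Fin n), Set.range fun g : Fin n → G => (⟨g, s⟩ : SG G n) := by
    ext x
    simp only [Set.mem_univ, Set.mem_iUnion, true_iff]
    exact ⟨x.right, x.left, rfl⟩
  rw [h]
  exact isCompact_iUnion fun s => isCompact_range (continuous_mk_right s)

instance instT2SpaceSG [T2Space G] (n : ℕ) : T2Space (SG G n) := by
  let _ : TopologicalSpace (Equiv.Perm (Fin n)) := ⊥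
  have : DiscreteTopology (Equiv.Perm (Fin n)) := ⟨rfl⟩
  refine T2Space.of_injective_continuous (f := fun x : SG G n => (x.left, x.right)) ?_ ?_
  · intro x y h
    exact SemidirectProduct.ext (congrArg Prod.fst h) (congrArg Prod.snd h)
  · exact continuous_left.prodMk isLocallyConstant_right.continuous

instance instIsTopologicalGroupSG [IsTopologicalGroup G] (n : ℕ) :
    IsTopologicalGroup (SG G n) where
  continuous_mul := by
    have h1 : IsLocallyConstant fun p : SG G n × SG G n => p.1.right :=
      isLocallyConstant_right.comp_continuous continuous_fst
    have h2 : IsLocallyConstant fun p : SG G n × SG G n => p.2.right :=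
      isLocallyConstant_right.comp_continuous continuous_snd
    refine continuous_SG_iff.2 ⟨fun i => ?_, ?_⟩
    · simp only [mul_left_apply]
      refine ((continuous_apply i).comp (continuous_left.comp continuous_fst)).mul ?_
      exact continuous_of_isLocallyConstant h1
        (F := fun s (p : SG G n × SG G n) => p.2.left (s⁻¹ i))
        fun s => (continuous_apply _).comp (continuous_left.comp continuous_snd)
    · exact h1.comp₂ h2 (fun a b => a * b)
  continuous_inv := by
    refine continuous_SG_iff.2 ⟨fun i => ?_, isLocallyConstant_right.comp fun s => s⁻¹⟩
    change Continuous fun x : SG G n => (x.left (x.right⁻¹⁻¹ i))⁻¹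
    refine Continuous.inv ?_
    exact continuous_of_isLocallyConstant isLocallyConstant_right
      (F := fun s (x : SG G n) => x.left (s⁻¹⁻¹ i))
      fun s => (continuous_apply _).comp continuous_left

theorem continuous_proj [ContinuousMul G] (n : ℕ) : Continuous (proj (G := G) n) := by
  have hc : ∀ i, Continuous fun x : SG G (n + 1) => x.left i := fun i =>
    (continuous_apply i).comp continuous_left
  refine continuous_SG_iff.2 ⟨fun j => ?_, isLocallyConstant_right.comp projPerm⟩
  refine continuous_of_isLocallyConstant isLocallyConstant_right
    (F := fun s (x : SG G (n + 1)) => if s (Fin.last n) = j.castSucc then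
      x.left j.castSucc * x.left (Fin.last n) else x.left j.castSucc) fun s => ?_
  split_ifs
  · exact (hc _).mul (hc _)
  · exact hc _

theorem continuous_lastWeight {z : ConjClasses G → ℂ}
    (hz : Continuous fun g : G => z (ConjClasses.mk g)) (n : ℕ) :
    Continuous (lastWeight z : SG G (n + 1) → ℝ) := by
  refine continuous_of_isLocallyConstant isLocallyConstant_right
    (F := fun s (x : SG G (n + 1)) => if s (Fin.last n) = Fin.last n then
      Complex.normSq (z (ConjClasses.mk (x.left (Fin.last n)))) else 1) fun s => ?_
  split_ifs
  · exact Complex.continuous_normSq.comp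
      (hz.comp ((continuous_apply _).comp continuous_left))
  · exact continuous_const

/-- The number of cycles of a given colour is not continuous in the entries, so the product over
colours is not treated factor by factor; the recursion `weight_eq_proj` gives continuity by
induction. -/
theorem continuous_weight [ContinuousMul G] {z : ConjClasses G → ℂ}
    (hz : Continuous fun g : G => z (ConjClasses.mk g)) (n : ℕ) :
    Continuous (weight z : SG G n → ℝ) := by
  induction n with
  | zero =>
    rw [show (weight z : SG G 0 → ℝ) = fun _ => 1 from funext fun x => weight_zero z x]
    exact continuous_const
  | succ n ih =>
    rw [show (weight z : SG G (n + 1) → ℝ) = fun x => weight z (proj n x) * lastWeight z x from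
      funext fun x => weight_eq_proj z x]
    exact (ih.comp (continuous_proj n)).mul (continuous_lastWeight hz n)

theorem measurable_weight [ContinuousMul G] {z : ConjClasses G → ℂ}
    (hz : Continuous fun g : G => z (ConjClasses.mk g)) (n : ℕ) :
    Measurable fun x : SG G n => ENNReal.ofReal (weight z x) :=
  (continuous_weight hz n).measurable.ennreal_ofReal

/-! ### The space of virtual permutations -/

theorem Virtual.continuous_coord (n : ℕ) : Continuous (Virtual.coord (G := G) n) :=
  (continuous_apply n).comp continuous_subtype_val

theorem Virtual.continuous_of_coord_of_le [ContinuousMul G] {X : Type*} [TopologicalSpace X]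
    {f : X → Virtual G} (N : ℕ) (hf : ∀ n, N ≤ n → Continuous fun a => (f a).coord n) :
    Continuous f := by
  refine continuous_induced_rng.2 (continuous_pi fun n => ?_)
  change Continuous fun a => (f a).coord n
  have key : ∀ k m, N ≤ m + k → Continuous fun a => (f a).coord m := by
    intro k
    induction k with
    | zero => exact hf
    | succ k ih =>
      intro m hm
      simp only [← Virtual.proj_coord m]
      exact (continuous_proj m).comp (ih (m + 1) (by omega))
  exact key N n (Nat.le_add_left _ _)

instance instT2SpaceVirtual [T2Space G] : T2Space (Virtual G) :=
  inferInstanceAs (T2Space {x : ∀ n, SG G n // ∀ n, proj n (x (n + 1)) = x n})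

instance instCompactSpaceVirtual [ContinuousMul G] [CompactSpace G] [T2Space G] :
    CompactSpace (Virtual G) := by
  have h : IsClosed {x : ∀ n, SG G n | ∀ n, proj n (x (n + 1)) = x n} := by
    simp only [Set.ofPred_forall]
    exact isClosed_iInter fun n =>
      isClosed_eq ((continuous_proj n).comp (continuous_apply (n + 1))) (continuous_apply n)
  exact isCompact_iff_compactSpace.1 h.isCompact

theorem Virtual.continuous_act [IsTopologicalGroup G] (W : SInf G × SInf G) :
    Continuous (Virtual.act W) := by
  obtain ⟨N, hN⟩ := exists_inStage W
  refine Virtual.continuous_of_coord_of_le N fun n hn => ?_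
  obtain ⟨⟨a, ha⟩, ⟨b, hb⟩⟩ := hN.mono hn
  simp only [Virtual.coord_act W _ n a b ha hb]
  exact (continuous_const.mul (Virtual.continuous_coord n)).mul continuous_const

theorem continuous_density [IsTopologicalGroup G] {z : ConjClasses G → ℂ}
    (hz : Continuous fun g : G => z (ConjClasses.mk g)) (hz0 : ∀ c, z c ≠ 0)
    (W : SInf G × SInf G) : Continuous fun x => density z x W := by
  obtain ⟨n, hn⟩ := exists_inStage W
  simp only [density_eq_div hz0 hn]
  exact ((continuous_weight hz n).comp ((Virtual.continuous_coord n).comp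
    (Virtual.continuous_act W))).div ((continuous_weight hz n).comp (Virtual.continuous_coord n))
    fun x => (weight_pos hz0 _).ne'

/-! ### Sections of the coordinate maps -/

theorem continuous_lift {n : ℕ} : Continuous (lift : SG G n → SG G (n + 1)) := by
  refine continuous_SG_iff.2 ⟨fun i => ?_, isLocallyConstant_right.comp fun s : Equiv.Perm (Fin n) =>
    finSuccEquivLast.symm.permCongr s.optionCongr⟩
  rcases Fin.eq_castSucc_or_eq_last i with ⟨k, rfl⟩ | rfl
  · simpa [lift] using continuous_pi_iff.1 continuous_left k
  · simpa [lift] using continuous_const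

/-- Obtained by adding fixed points with trivial entries. These sections transport measures on
$S_n(G)$ to virtual permutations. -/
theorem Virtual.exists_continuous_section [ContinuousMul G] (n : ℕ) :
    ∃ f : SG G n → Virtual G, Continuous f ∧ ∀ y, (f y).coord n = y := by
  let F : SG G n → ∀ m, SG G m := fun y m =>
    if h : n ≤ m then Nat.leRecOn (C := fun m => SG G m) h (fun {_} => lift) y else 1
  have hF0 : ∀ y, F y n = y := fun y => by
    simp only [F, le_refl, dite_true]
    exact Nat.leRecOn_self y
  have hF1 : ∀ y m, n ≤ m → F y (m + 1) = lift (F y m) := fun y m hm => by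
    simp only [F, hm, Nat.le_succ_of_le hm, dite_true]
    exact Nat.leRecOn_succ hm y
  have hex := fun y => Virtual.exists_of_tail n (F y) fun m hm => by rw [hF1 y m hm, proj_lift]
  choose f hf using hex
  refine ⟨f, Virtual.continuous_of_coord_of_le n fun m hm => ?_, fun y => ?_⟩
  · simp only [hf _ m hm]
    induction m, hm using Nat.le_induction with
    | base => simpa only [hF0] using continuous_id'
    | succ m hm ih => simpa only [hF1 _ m hm] using continuous_lift.comp' ih
  · rw [hf y n le_rfl, hF0]

/-! ### Cylinder sets -/

theorem Virtual.exists_continuous_of_le [ContinuousMul G] {m n : ℕ} (hmn : m ≤ n) :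
    ∃ p : SG G n → SG G m, Continuous p ∧ ∀ x : Virtual G, p (x.coord n) = x.coord m := by
  induction n, hmn using Nat.le_induction with
  | base => exact ⟨id, continuous_id, fun _ => rfl⟩
  | succ n hn ih =>
    obtain ⟨p, hp, hp'⟩ := ih
    exact ⟨p ∘ proj n, hp.comp (continuous_proj n), fun x => by
      rw [Function.comp_apply, Virtual.proj_coord, hp']⟩

/-- A basic open set constrains finitely many coordinates, all functions of the largest one. Taking
at each stage the largest open set whose cylinder lies in `U` makes the union countable without any
countability assumption on `G`. -/
theorem Virtual.eq_iUnion_preimage_coord [ContinuousMul G] {U : Set (Virtual G)} (hU : IsOpen U) :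
    ∃ O : ∀ n, Set (SG G n), (∀ n, IsOpen (O n)) ∧ U = ⋃ n, Virtual.coord n ⁻¹' O n := by
  refine ⟨fun n => ⋃₀ {A | IsOpen A ∧ Virtual.coord n ⁻¹' A ⊆ U},
    fun n => isOpen_sUnion fun A hA => hA.1, ?_⟩
  apply Set.Subset.antisymm
  · intro x hx
    obtain ⟨V, hV, rfl⟩ := isOpen_induced_iff.1 hU
    obtain ⟨I, u, hu, huV⟩ := isOpen_pi_iff.1 hV x.1 hx
    obtain ⟨N, hN⟩ : ∃ N, ∀ i ∈ I, i ≤ N := ⟨I.sup id, fun i hi => Finset.le_sup (f := id) hi⟩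
    choose p hp hp' using fun i : I => Virtual.exists_continuous_of_le (G := G) (hN i i.2)
    refine Set.mem_iUnion.2 ⟨N, ⋂ i : I, p i ⁻¹' u i, ⟨isOpen_iInter_of_finite fun i =>
      (hu i i.2).1.preimage (hp i), fun y hy => huV fun i hi => ?_⟩, Set.mem_iInter.2 fun i => ?_⟩
    · have := Set.mem_iInter.1 hy ⟨i, hi⟩
      rwa [Set.mem_preimage, hp' ⟨i, hi⟩ y] at this
    · rw [Set.mem_preimage, hp' i x]
      exact (hu i i.2).2
  · refine Set.iUnion_subset fun n x hx => ?_
    obtain ⟨A, hA, hxA⟩ := hx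
    exact hA.2 hxA

end Topology

/-! ### Generalities on measures -/

section General

/-- Absolute continuity of the integral: a compact `K` in `A` with `m (A \ K)` small enough loses
less than the slack `m.withDensity f A - r`. -/
theorem innerRegular_withDensity {X : Type*} [TopologicalSpace X] [T2Space X] [MeasurableSpace X]
    [BorelSpace X] (m : Measure X) [IsFiniteMeasure m] [m.InnerRegularCompactLTTop]
    {f : X → ENNReal} (hf : ∫⁻ x, f x ∂m ≠ ⊤) : (m.withDensity f).InnerRegular := by
  refine ⟨fun A hA r hr => ?_⟩
  have hfin : m.withDensity f A ≠ ⊤ := by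
    rw [withDensity_apply f hA]
    exact ((setLIntegral_le_lintegral A f).trans_lt hf.lt_top).ne
  obtain ⟨δ, hδ, hlt⟩ := exists_pos_setLIntegral_lt_of_measure_lt hf (tsub_pos_of_lt hr).ne'
  obtain ⟨K, hKA, hK, hKδ⟩ := hA.exists_isCompact_sdiff_lt (measure_ne_top m A) hδ.ne'
  refine ⟨K, hKA, hK, ?_⟩
  by_contra! hle
  have h1 := hlt _ hKδ
  rw [← withDensity_apply f (hA.diff hK.measurableSet)] at h1
  have h2 : m.withDensity f A ≤ m.withDensity f K + m.withDensity f (A \ K) := by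
    rw [measure_add_sdiff hK.measurableSet.nullMeasurableSet, Set.union_eq_self_of_subset_left hKA]
  have h3 : m.withDensity f K + m.withDensity f (A \ K) <
      r + (m.withDensity f A - r) :=
    ENNReal.add_lt_add_of_le_of_lt (ne_top_of_le_ne_top hr.ne_top hle) hle h1
  rw [add_tsub_cancel_of_le hr.le] at h3
  exact (h2.trans_lt h3).false

theorem map_withDensity_comp {X Y : Type*} [MeasurableSpace X] [MeasurableSpace Y]
    (m : Measure X) {T : X → Y} (hT : Measurable T) {f : Y → ENNReal} (hf : Measurable f) :
    (m.withDensity (f ∘ T)).map T = (m.map T).withDensity f := by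
  ext B hB
  rw [Measure.map_apply hT hB, withDensity_apply _ (hT hB), withDensity_apply _ hB,
    setLIntegral_map hB hf hT]
  rfl

/-- The image of a weighted invariant measure under a map that carries enough left translations
to left translations is a Haar measure. -/
theorem map_withDensity_eq_smul {K L : Type*} [Group K] [MeasurableSpace K] [MeasurableMul K]
    [Group L] [TopologicalSpace L] [IsTopologicalGroup L] [CompactSpace L] [MeasurableSpace L]
    [BorelSpace L] (m : Measure K) [m.IsMulLeftInvariant] (μ : Measure L)
    [IsProbabilityMeasure μ] [μ.IsHaarMeasure] {T : K → L} (hT : Measurable T)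
    {w : K → ENNReal} (hfin : ∫⁻ x, w x ∂m ≠ ⊤)
    (h : ∀ l, ∃ k, ∀ x, T (k * x) = l * T x ∧ w (k * x) = w x) :
    (m.withDensity w).map T = (∫⁻ x, w x ∂m) • μ := by
  set ρ := (m.withDensity w).map T with hρ
  have huniv : ρ Set.univ = ∫⁻ x, w x ∂m := by
    rw [hρ, Measure.map_apply hT MeasurableSet.univ, Set.preimage_univ,
      withDensity_apply _ MeasurableSet.univ, setLIntegral_univ]
  have : IsFiniteMeasure ρ := ⟨by rw [huniv]; exact hfin.lt_top⟩
  have hρB : ∀ B, MeasurableSet B → ρ B = ∫⁻ x, (T ⁻¹' B).indicator w x ∂m := fun B hB => by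
    rw [hρ, Measure.map_apply hT hB, withDensity_apply _ (hT hB), lintegral_indicator (hT hB)]
  have : ρ.IsMulLeftInvariant := by
    refine ⟨fun l => ?_⟩
    obtain ⟨k, hk⟩ := h l
    ext B hB
    have hl : Measurable fun y : L => l * y := (continuous_const_mul l).measurable
    rw [Measure.map_apply hl hB, hρB _ (hl hB), hρB B hB,
      -- Substituting `k * x` for `x` moves the translation by `l` on the target back to the source,
      -- where `m` is invariant and `w` is unchanged.
      ← lintegral_mul_left_eq_self ((T ⁻¹' B).indicator w) k]
    refine lintegral_congr fun x => ?_
    have hiff : x ∈ T ⁻¹' ((fun y => l * y) ⁻¹' B) ↔ k * x ∈ T ⁻¹' B := by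
      rw [Set.mem_preimage, Set.mem_preimage, Set.mem_preimage, (hk x).1]
    by_cases hx : k * x ∈ T ⁻¹' B
    · rw [Set.indicator_of_mem hx, Set.indicator_of_mem (hiff.2 hx), (hk x).2]
    · rw [Set.indicator_of_notMem hx, Set.indicator_of_notMem (mt hiff.1 hx)]
  have hsm := Measure.isMulInvariant_eq_smul_of_compactSpace ρ μ
  have hc : ((Measure.haarScalarFactor ρ μ : NNReal) : ENNReal) = ∫⁻ x, w x ∂m := by
    rw [← huniv]
    conv_rhs => rw [hsm]
    rw [Measure.smul_apply, measure_univ, ENNReal.smul_def, smul_eq_mul, mul_one]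
  rw [hsm, ← hc]
  rfl

theorem map_eq_of_mul_left {K L : Type*} [Group K] [MeasurableSpace K] [MeasurableMul K]
    [Group L] [TopologicalSpace L] [IsTopologicalGroup L] [CompactSpace L] [MeasurableSpace L]
    [BorelSpace L] (m : Measure K) [m.IsMulLeftInvariant] [IsProbabilityMeasure m]
    (μ : Measure L) [IsProbabilityMeasure μ] [μ.IsHaarMeasure] {T : K → L} (hT : Measurable T)
    (h : ∀ l, ∃ k, ∀ x, T (k * x) = l * T x) : m.map T = μ := by
  have := map_withDensity_eq_smul m μ hT (w := 1) (by simp)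
    (fun l => (h l).imp fun k hk x => ⟨hk x, rfl⟩)
  simpa using this

theorem isProbabilityMeasure_haarMeasure_top {K : Type*} [Group K] [TopologicalSpace K]
    [IsTopologicalGroup K] [CompactSpace K] [MeasurableSpace K] [BorelSpace K] :
    IsProbabilityMeasure (Measure.haarMeasure (⊤ : TopologicalSpace.PositiveCompacts K)) :=
  ⟨Measure.haarMeasure_self (K₀ := ⊤)⟩

end General

section Haar

variable {G : Type*} [Group G] [TopologicalSpace G] [IsTopologicalGroup G] [CompactSpace G]

/-! ### The invariant measure of the wreath product -/

theorem haarPow_univ (n : ℕ) :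
    @DFunLike.coe _ _ _ (@Measure.instFunLike (Fin n → G) (borel _)) (haarPow G n) Set.univ = 1 :=
  let _ : MeasurableSpace (Fin n → G) := borel _
  have : BorelSpace (Fin n → G) := ⟨rfl⟩
  Measure.haarMeasure_self (K₀ := ⊤)

theorem map_haarPow (n : ℕ) (h : Fin n → G) (t : Equiv.Perm (Fin n)) :
    @Measure.map _ _ (borel _) (borel _) (fun (g : Fin n → G) i => h i * g (t i)) (haarPow G n) =
      haarPow G n := by
  let _ : MeasurableSpace (Fin n → G) := borel _
  have : BorelSpace (Fin n → G) := ⟨rfl⟩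
  have : IsProbabilityMeasure (haarPow G n) := isProbabilityMeasure_haarMeasure_top
  have : (haarPow G n).IsHaarMeasure := Measure.isHaarMeasure_haarMeasure ⊤
  -- The translation `k` on the source must satisfy `h i * k (t i) = l i * h i`; this is solved for
  -- `k` at the index `t i`.
  refine map_eq_of_mul_left _ _ ?_ fun l => ⟨fun i => (h (t.symm i))⁻¹ * l (t.symm i) *
    h (t.symm i), fun x => funext fun i => ?_⟩
  · exact (continuous_pi fun i => continuous_const.mul (continuous_apply (t i))).measurable
  · simp [mul_assoc]

theorem lintegral_haarPow_eval [MeasurableSpace G] [BorelSpace G] (n : ℕ) (i : Fin n)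
    {f : G → ENNReal} (hf : Measurable f) :
    @lintegral (Fin n → G) (borel _) (haarPow G n) (fun g => f (g i)) = ∫⁻ g, f g ∂(haarG G) := by
  let _ : MeasurableSpace (Fin n → G) := borel _
  have : BorelSpace (Fin n → G) := ⟨rfl⟩
  have : IsProbabilityMeasure (haarPow G n) := isProbabilityMeasure_haarMeasure_top
  have : (haarPow G n).IsHaarMeasure := Measure.isHaarMeasure_haarMeasure ⊤
  have : IsProbabilityMeasure (haarG G) := isProbabilityMeasure_haarMeasure_top
  have : (haarG G).IsHaarMeasure := Measure.isHaarMeasure_haarMeasure ⊤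
  have hm : Measurable fun g : Fin n → G => g i := (continuous_apply i).measurable
  rw [← map_eq_of_mul_left (haarPow G n) (haarG G) hm fun l => ⟨fun _ => l, fun x => rfl⟩,
    lintegral_map hf hm]

theorem lintegral_wreathHaar (n : ℕ) {f : SG G n → ENNReal} (hf : Measurable f) :
    ∫⁻ x, f x ∂(wreathHaar G n) = (n.factorial : ENNReal)⁻¹ * ∑ s : Equiv.Perm (Fin n),
      @lintegral (Fin n → G) (borel _) (haarPow G n) fun g => f ⟨g, s⟩ := by
  let _ : MeasurableSpace (Fin n → G) := borel _
  have : BorelSpace (Fin n → G) := ⟨rfl⟩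
  rw [wreathHaar, lintegral_smul_measure, lintegral_finsetSum_measure, smul_eq_mul]
  congr 1
  exact Finset.sum_congr rfl fun s _ => lintegral_map hf (continuous_mk_right s).measurable

theorem wreathHaar_apply (n : ℕ) {B : Set (SG G n)} (hB : MeasurableSet B) :
    wreathHaar G n B = (n.factorial : ENNReal)⁻¹ * ∑ s : Equiv.Perm (Fin n),
      @DFunLike.coe _ _ _ (@Measure.instFunLike (Fin n → G) (borel _)) (haarPow G n)
        {g | (⟨g, s⟩ : SG G n) ∈ B} := by
  let _ : MeasurableSpace (Fin n → G) := borel _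
  have : BorelSpace (Fin n → G) := ⟨rfl⟩
  rw [wreathHaar, Measure.smul_apply, Measure.finsetSum_apply, smul_eq_mul]
  congr 1
  exact Finset.sum_congr rfl fun s _ => Measure.map_apply (continuous_mk_right s).measurable hB

instance instIsProbabilityMeasureWreathHaar (n : ℕ) : IsProbabilityMeasure (wreathHaar G n) := by
  constructor
  rw [wreathHaar_apply n MeasurableSet.univ]
  simp only [Set.mem_univ, Set.ofPred_true, haarPow_univ]
  rw [Finset.sum_const, Finset.card_univ, Fintype.card_perm, Fintype.card_fin, nsmul_eq_mul,
    mul_one]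
  exact ENNReal.inv_mul_cancel (by exact_mod_cast n.factorial_ne_zero) (ENNReal.natCast_ne_top _)

instance instIsMulLeftInvariantWreathHaar (n : ℕ) : (wreathHaar G n).IsMulLeftInvariant := by
  refine ⟨fun v => ?_⟩
  ext B hB
  have hv : Measurable fun x : SG G n => v * x := (continuous_const_mul v).measurable
  rw [Measure.map_apply hv hB, wreathHaar_apply n (hv hB), wreathHaar_apply n hB]
  congr 1
  -- Left multiplication by `v` permutes the sheets `s` by `v.right`, and within a sheet it permutes
  -- and translates the entries, which `map_haarPow` allows.
  refine Fintype.sum_equiv (Equiv.mulLeft v.right) _ _ fun s => ?_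
  let _ : MeasurableSpace (Fin n → G) := borel _
  have : BorelSpace (Fin n → G) := ⟨rfl⟩
  conv_rhs => rw [← map_haarPow n v.left v.right⁻¹]
  have hm : Measurable fun (g : Fin n → G) i => v.left i * g (v.right⁻¹ i) :=
    (continuous_pi fun i => continuous_const.mul (continuous_apply (v.right⁻¹ i))).measurable
  exact (Measure.map_apply hm ((continuous_mk_right (v.right * s)).measurable hB)).symm

instance instIsHaarMeasureWreathHaar (n : ℕ) : (wreathHaar G n).IsHaarMeasure :=
  Measure.isHaarMeasure_of_isCompact_nonempty_interior _ Set.univ isCompact_univ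
    (by simp) (by simp) (by simp)

/-- Two-sided invariance of Haar measure on a compact group: the image is again a left invariant
probability measure, translation by `l` being induced by translation by `v⁻¹ * l * v`. -/
theorem map_mul_mul_wreathHaar {n : ℕ} (v w : SG G n) :
    (wreathHaar G n).map (fun x => v * x * w) = wreathHaar G n := by
  refine map_eq_of_mul_left _ _ ((continuous_const.mul continuous_id).mul
    continuous_const).measurable fun l => ⟨v⁻¹ * l * v, fun x => ?_⟩
  group

/-! ### Consistency of the Ewens measures -/

variable [MeasurableSpace G] [BorelSpace G]

theorem integrable_normSq {z : ConjClasses G → ℂ}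
    (hz : Continuous fun g : G => z (ConjClasses.mk g)) :
    Integrable (fun g : G => ‖z (ConjClasses.mk g)‖ ^ 2) (haarG G) := by
  have : IsProbabilityMeasure (haarG G) := isProbabilityMeasure_haarMeasure_top
  exact (hz.norm.pow 2).integrable_of_hasCompactSupport (HasCompactSupport.of_compactSpace _)

theorem paramI_pos {z : ConjClasses G → ℂ}
    (hz : Continuous fun g : G => z (ConjClasses.mk g)) (hz0 : ∀ c, z c ≠ 0) : 0 < paramI z := by
  have : IsProbabilityMeasure (haarG G) := isProbabilityMeasure_haarMeasure_top
  refine (integral_pos_iff_support_of_nonneg (fun g => by positivity) (integrable_normSq hz)).2 ?_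
  rw [show (Function.support fun g : G => ‖z (ConjClasses.mk g)‖ ^ 2) = Set.univ from
    Set.eq_univ_of_forall fun g => by simp [hz0]]
  simp

theorem sum_perm_last {M : Type*} [Semiring M] (n : ℕ) (f : Fin (n + 1) → M) :
    ∑ s : Equiv.Perm (Fin (n + 1)), f (s (Fin.last n)) = n.factorial * ∑ j, f j := by
  -- `decomposeFin` splits off the image of `0`, so the last point is first exchanged with `0`.
  rw [Fintype.sum_equiv (Equiv.mulRight (Equiv.swap 0 (Fin.last n)))
    (fun s : Equiv.Perm (Fin (n + 1)) => f (s (Fin.last n))) (fun s => f (s 0)) (by simp),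
    ← Equiv.sum_comp (Equiv.Perm.decomposeFin (n := n)).symm, Fintype.sum_prod_type]
  simp [Fintype.card_perm, Finset.mul_sum]

/-- The last point is fixed with probability $1/(n+1)$, and then contributes $I$ on average;
otherwise it contributes $1$. -/
theorem lintegral_lastWeight {z : ConjClasses G → ℂ}
    (hz : Continuous fun g : G => z (ConjClasses.mk g)) (n : ℕ) :
    ∫⁻ x : SG G (n + 1), ENNReal.ofReal (lastWeight z x) ∂(wreathHaar G (n + 1)) =
      ENNReal.ofReal ((paramI z + n) / (n + 1)) := by
  have hI : 0 ≤ paramI z := integral_nonneg fun g => by positivity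
  have hm : Measurable fun g : G => ENNReal.ofReal (Complex.normSq (z (ConjClasses.mk g))) :=
    (Complex.continuous_normSq.comp hz).measurable.ennreal_ofReal
  have hint : ∫⁻ g, ENNReal.ofReal (Complex.normSq (z (ConjClasses.mk g))) ∂(haarG G) =
      ENNReal.ofReal (paramI z) := by
    rw [paramI, ofReal_integral_eq_lintegral_ofReal (integrable_normSq hz)
      (Filter.Eventually.of_forall fun g => by positivity)]
    simp only [Complex.normSq_eq_norm_sq]
  rw [lintegral_wreathHaar _ (continuous_lastWeight hz n).measurable.ennreal_ofReal]
  have hs : ∀ s : Equiv.Perm (Fin (n + 1)),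
      (@lintegral (Fin (n + 1) → G) (borel _) (haarPow G (n + 1)) fun g =>
        ENNReal.ofReal (lastWeight z (⟨g, s⟩ : SG G (n + 1)))) =
      ENNReal.ofReal (if s (Fin.last n) = Fin.last n then paramI z else 1) := by
    intro s
    by_cases h : s (Fin.last n) = Fin.last n
    · simp only [lastWeight, h, if_true]
      rw [lintegral_haarPow_eval (n + 1) (Fin.last n) hm, hint]
    · simp only [lastWeight, h, if_false]
      rw [lintegral_const, haarPow_univ, mul_one]
  simp only [hs]
  rw [← ENNReal.ofReal_sum_of_nonneg fun s _ => by split_ifs <;> positivity,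
    sum_perm_last n fun j => if j = Fin.last n then paramI z else 1, ← ENNReal.ofReal_natCast,
    ← ENNReal.ofReal_inv_of_pos (by positivity), ← ENNReal.ofReal_mul (by positivity)]
  congr 1
  rw [Fin.sum_univ_castSucc]
  simp only [(Fin.castSucc_lt_last _).ne, if_true, if_false]
  simp only [Finset.sum_const, Finset.card_univ, Fintype.card_fin, nsmul_eq_mul, mul_one,
    Nat.factorial_succ, Nat.cast_mul, Nat.cast_add, Nat.cast_one]
  field_simp
  ring

/-- The normalizing constant of the Ewens measure. -/
def ewensConst (n : ℕ) (z : ConjClasses G → ℂ) : ℝ :=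
  n.factorial / ∏ k ∈ Finset.range n, (paramI z + k)

theorem ewensConst_pos {z : ConjClasses G → ℂ}
    (hz : Continuous fun g : G => z (ConjClasses.mk g)) (hz0 : ∀ c, z c ≠ 0) (n : ℕ) :
    0 < ewensConst n z := by
  have hI := paramI_pos hz hz0
  exact div_pos (by positivity) (Finset.prod_pos fun k _ => by positivity)

theorem ewensConst_succ_mul {z : ConjClasses G → ℂ}
    (hz : Continuous fun g : G => z (ConjClasses.mk g)) (hz0 : ∀ c, z c ≠ 0) (n : ℕ) :
    ewensConst (n + 1) z * ((paramI z + n) / (n + 1)) = ewensConst n z := by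
  have hI := paramI_pos hz hz0
  have hprod : 0 < ∏ k ∈ Finset.range n, (paramI z + k) :=
    Finset.prod_pos fun k _ => by positivity
  rw [ewensConst, ewensConst, Finset.prod_range_succ, Nat.factorial_succ]
  push_cast
  have : paramI z + n ≠ 0 := by positivity
  field_simp

theorem ewensDensity_eq (n : ℕ) (z : ConjClasses G → ℂ) (x : SG G n) :
    ewensDensity n z x = ewensConst n z * weight z x := by
  rw [ewensDensity, ewensConst, weight]
  ring

theorem ewens_eq_smul {z : ConjClasses G → ℂ}
    (hz : Continuous fun g : G => z (ConjClasses.mk g)) (hz0 : ∀ c, z c ≠ 0) (n : ℕ) :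
    ewens n z = ENNReal.ofReal (ewensConst n z) •
      (wreathHaar G n).withDensity fun x => ENNReal.ofReal (weight z x) := by
  rw [← withDensity_smul _ (measurable_weight hz n), ewens]
  congr 1
  ext x
  rw [ewensDensity_eq, ENNReal.ofReal_mul (ewensConst_pos hz hz0 n).le]
  rfl

/-- The weight of the projection is a function on the target and can be pulled out of the image
measure; what remains is Haar measure weighted by `lastWeight`, whose image is a multiple of Haar
measure. -/
theorem map_proj_ewens {z : ConjClasses G → ℂ}
    (hz : Continuous fun g : G => z (ConjClasses.mk g)) (hz0 : ∀ c, z c ≠ 0) (n : ℕ) :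
    (ewens (n + 1) z).map (proj n) = ewens n z := by
  have hI := paramI_pos hz hz0
  have hp : Measurable (proj (G := G) n) := (continuous_proj n).measurable
  have hl : Measurable fun x : SG G (n + 1) => ENNReal.ofReal (lastWeight z x) :=
    (continuous_lastWeight hz n).measurable.ennreal_ofReal
  have hw := measurable_weight hz n
  have hw' : (fun x : SG G (n + 1) => ENNReal.ofReal (weight z x)) =
      (fun x => ENNReal.ofReal (lastWeight z x)) *
        ((fun y : SG G n => ENNReal.ofReal (weight z y)) ∘ proj n) := by
    ext x
    rw [weight_eq_proj, mul_comm, ENNReal.ofReal_mul (lastWeight_pos hz0 x).le]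
    rfl
  have hmap := map_withDensity_eq_smul (wreathHaar G (n + 1)) (wreathHaar G n) hp
    (w := fun x => ENNReal.ofReal (lastWeight z x))
    (by rw [lintegral_lastWeight hz]; exact ENNReal.ofReal_ne_top) fun v => by
      obtain ⟨v', hv'⟩ := exists_incl_succ_eq v
      exact ⟨v', fun x => ⟨proj_mul_left hv' x, by rw [lastWeight_mul_left hv']⟩⟩
  rw [ewens_eq_smul hz hz0, ewens_eq_smul hz hz0, Measure.map_smul, hw',
    withDensity_mul _ hl (hw.comp hp), map_withDensity_comp _ hp hw, hmap,
    lintegral_lastWeight hz, withDensity_smul_measure, smul_smul,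
    ← ENNReal.ofReal_mul (ewensConst_pos hz hz0 _).le, ewensConst_succ_mul hz hz0]

/-- Projections preserve total mass, so everything reduces to the one-point stage; no generating
function for cycles is needed. -/
theorem isProbabilityMeasure_ewens {z : ConjClasses G → ℂ}
    (hz : Continuous fun g : G => z (ConjClasses.mk g)) (hz0 : ∀ c, z c ≠ 0) (n : ℕ) :
    IsProbabilityMeasure (ewens n z) := by
  constructor
  induction n with
  | zero => rw [ewens_eq_smul hz hz0]; simp [ewensConst, weight_zero]
  | succ n ih =>
    rw [← ih, ← map_proj_ewens hz hz0 n,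
      Measure.map_apply (continuous_proj n).measurable MeasurableSet.univ, Set.preimage_univ]

theorem innerRegular_ewens [T2Space G] {z : ConjClasses G → ℂ}
    (hz : Continuous fun g : G => z (ConjClasses.mk g)) (hz0 : ∀ c, z c ≠ 0) (n : ℕ) :
    (ewens n z).InnerRegular := by
  have := isProbabilityMeasure_ewens hz hz0 n
  refine innerRegular_withDensity _ ?_
  rw [← setLIntegral_univ, ← withDensity_apply _ MeasurableSet.univ]
  exact measure_ne_top (ewens n z) Set.univ

end Haar

section Limit

variable {G : Type*} [Group G] [TopologicalSpace G]

/-! ### Measures on the space of virtual permutations -/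

theorem Virtual.measurable_coord (n : ℕ) : Measurable (Virtual.coord (G := G) n) :=
  (Virtual.continuous_coord n).measurable

theorem Virtual.exists_preimage_coord_eq [ContinuousMul G] {m n : ℕ} (hmn : m ≤ n)
    {B : Set (SG G m)} (hB : MeasurableSet B) :
    ∃ B' : Set (SG G n), MeasurableSet B' ∧ Virtual.coord m ⁻¹' B = Virtual.coord n ⁻¹' B' := by
  obtain ⟨p, hp, hp'⟩ := Virtual.exists_continuous_of_le (G := G) hmn
  refine ⟨p ⁻¹' B, hp.measurable hB, ?_⟩
  ext x
  rw [Set.mem_preimage, Set.mem_preimage, Set.mem_preimage, hp']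

/-- Only stages from `N` on are used, so that measures can be compared at stages containing a given
`W`. -/
theorem Virtual.measurableSpace_eq_generateFrom [ContinuousMul G] (N : ℕ) :
    (instMeasurableSpaceVirtual : MeasurableSpace (Virtual G)) = MeasurableSpace.generateFrom
      {A | ∃ n, N ≤ n ∧ ∃ B : Set (SG G n), MeasurableSet B ∧ A = Virtual.coord n ⁻¹' B} := by
  apply le_antisymm
  · refine MeasurableSpace.generateFrom_le fun U hU => ?_
    obtain ⟨O, hO, rfl⟩ := Virtual.eq_iUnion_preimage_coord hU
    refine MeasurableSet.iUnion fun n => MeasurableSpace.measurableSet_generateFrom ?_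
    obtain ⟨B, hB, h⟩ := Virtual.exists_preimage_coord_eq (le_max_left n N) (hO n).measurableSet
    exact ⟨max n N, le_max_right _ _, B, hB, h⟩
  · refine MeasurableSpace.generateFrom_le ?_
    rintro _ ⟨n, -, B, hB, rfl⟩
    exact Virtual.measurable_coord n hB

theorem Virtual.measure_ext [ContinuousMul G] {μ ν : Measure (Virtual G)} [IsFiniteMeasure μ]
    (N : ℕ) (h : ∀ n, N ≤ n → μ.map (Virtual.coord n) = ν.map (Virtual.coord n)) : μ = ν := by
  have happ : ∀ n, N ≤ n → ∀ B : Set (SG G n), MeasurableSet B →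
      μ (Virtual.coord n ⁻¹' B) = ν (Virtual.coord n ⁻¹' B) := fun n hn B hB => by
    rw [← Measure.map_apply (Virtual.measurable_coord n) hB, h n hn,
      Measure.map_apply (Virtual.measurable_coord n) hB]
  refine ext_of_generate_finite _ (Virtual.measurableSpace_eq_generateFrom N) ?_ ?_
    (happ N le_rfl Set.univ MeasurableSet.univ)
  · rintro _ ⟨m, hm, A, hA, rfl⟩ _ ⟨n, hn, B, hB, rfl⟩ -
    obtain ⟨A', hA', h1⟩ := Virtual.exists_preimage_coord_eq (le_max_left m n) hA
    obtain ⟨B', hB', h2⟩ := Virtual.exists_preimage_coord_eq (le_max_right m n) hB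
    rw [h1, h2]
    exact ⟨max m n, hm.trans (le_max_left _ _), A' ∩ B', hA'.inter hB', rfl⟩
  · rintro _ ⟨n, hn, B, hB, rfl⟩
    exact happ n hn B hB

/-- A consistent sequence of inner regular probability measures has a projective limit. -/
theorem Virtual.exists_measure_map_coord_eq [ContinuousMul G] [CompactSpace G] [T2Space G]
    (ν : ∀ n, Measure (SG G n)) [∀ n, IsProbabilityMeasure (ν n)] [∀ n, (ν n).InnerRegular]
    (hν : ∀ n, (ν (n + 1)).map (proj n) = ν n) :
    ∃ μ : Measure (Virtual G), IsProbabilityMeasure μ ∧ ∀ n, μ.map (Virtual.coord n) = ν n := by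
  choose f hf hf' using Virtual.exists_continuous_section (G := G)
  let P : ℕ → ProbabilityMeasure (Virtual G) := fun n =>
    ⟨(ν n).map (f n), Measure.isProbabilityMeasure_map (hf n).measurable.aemeasurable⟩
  -- By consistency, the lift of `ν n` has the correct marginals at all stages up to `n`.
  have hP : ∀ k n, k ≤ n → (P n : Measure (Virtual G)).map (Virtual.coord k) = ν k := by
    intro k n hkn
    induction hkn using Nat.decreasingInduction with
    | self =>
      change ((ν n).map (f n)).map _ = _
      rw [Measure.map_map (Virtual.measurable_coord n) (hf n).measurable]
      convert Measure.map_id using 2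
      exact funext (hf' n)
    | of_succ k hk ih =>
      rw [← hν k, ← ih, Measure.map_map (continuous_proj k).measurable
        (Virtual.measurable_coord _)]
      congr 1
      exact funext fun x => (Virtual.proj_coord k x).symm
  let F : Ultrafilter ℕ := Ultrafilter.of Filter.atTop
  -- An ultrafilter limit replaces a convergent subsequence, which compactness alone need not
  -- provide.
  obtain ⟨Q, -, hQ⟩ := isCompact_univ.ultrafilter_le_nhds (F.map P) (by simp)
  -- The limit `Q` is known only through integrals of continuous functions and is not known to be
  -- regular; it is replaced by a regular measure with the same integrals.
  obtain ⟨μ, hμ, hfin, hQμ⟩ :=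
    Measure.exists_regular_eq_of_compactSpace (Q : Measure (Virtual G))
  have hmap : ∀ n, μ.map (Virtual.coord n) = ν n := by
    intro n
    -- With inner regularity on both sides, equal integrals of continuous functions force equal
    -- measures.
    have : (μ.map (Virtual.coord n)).InnerRegular :=
      Measure.InnerRegular.map_of_continuous (Virtual.continuous_coord n)
    refine Measure.ext_of_integral_eq_on_compactlySupported fun φ => ?_
    rw [integral_map (Virtual.measurable_coord n).aemeasurable
      (map_continuous φ).aestronglyMeasurable]
    let g : BoundedContinuousFunction (Virtual G) ℝ := BoundedContinuousFunction.mkOfCompact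
      ⟨fun x => φ (x.coord n), φ.continuous.comp (Virtual.continuous_coord n)⟩
    have hlim := (ProbabilityMeasure.tendsto_iff_forall_integral_tendsto.1
      (show Filter.Tendsto P F (nhds Q) from hQ)) g
    -- A test function of the `n`-th coordinate has constant integral along the sequence from stage
    -- `n` on, so the limit has this integral too.
    have hev : (fun m => ∫ x, g x ∂(P m : Measure (Virtual G))) =ᶠ[F]
        fun _ => ∫ y, φ y ∂(ν n) := by
      filter_upwards [Ultrafilter.of_le Filter.atTop (Filter.eventually_ge_atTop n)] with m hm
      rw [← hP n m hm, integral_map (Virtual.measurable_coord n).aemeasurable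
        (map_continuous φ).aestronglyMeasurable]
      rfl
    have := tendsto_nhds_unique (hlim.congr' hev) tendsto_const_nhds
    rw [← this]
    exact (hQμ g).symm
  refine ⟨μ, ⟨?_⟩, hmap⟩
  have := measure_univ (μ := ν 0)
  rwa [← hmap 0, Measure.map_apply (Virtual.measurable_coord 0) MeasurableSet.univ,
    Set.preimage_univ] at this

/-! ### The Ewens measure on virtual permutations -/

variable [IsTopologicalGroup G] [CompactSpace G] [MeasurableSpace G] [BorelSpace G]

theorem existsUnique_isEwensLimit [T2Space G] {z : ConjClasses G → ℂ}
    (hz : Continuous fun g : G => z (ConjClasses.mk g)) (hz0 : ∀ c, z c ≠ 0) :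
    ∃! μ : Measure (Virtual G), IsEwensLimit z μ := by
  have := isProbabilityMeasure_ewens hz hz0
  have := innerRegular_ewens hz hz0
  obtain ⟨μ, hμ, hμ'⟩ :=
    Virtual.exists_measure_map_coord_eq (fun n => ewens n z) (map_proj_ewens hz hz0)
  exact ⟨μ, ⟨hμ, hμ'⟩, fun ν hν => (Virtual.measure_ext 0 fun n _ => by
    rw [hμ' n, hν.map_coord n]).symm⟩

/-- Haar measure does not change under the two-sided translation, so only the weight is transported;
dividing by the original weight gives the density. -/
theorem map_mul_mul_ewens {z : ConjClasses G → ℂ}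
    (hz : Continuous fun g : G => z (ConjClasses.mk g)) (hz0 : ∀ c, z c ≠ 0) {n : ℕ}
    (a b : SG G n) :
    (ewens n z).map (fun y => b * y * a⁻¹) = (ewens n z).withDensity
      fun y => ENNReal.ofReal (weight z (b⁻¹ * y * a) / weight z y) := by
  have hS : Measurable fun y : SG G n => b * y * a⁻¹ :=
    ((continuous_const.mul continuous_id).mul continuous_const).measurable
  have hc : Continuous fun y : SG G n => b⁻¹ * y * a :=
    (continuous_const.mul continuous_id).mul continuous_const
  have hw := measurable_weight hz n
  have hw' : Measurable fun y : SG G n => ENNReal.ofReal (weight z (b⁻¹ * y * a)) :=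
    hw.comp hc.measurable
  have hD : Measurable fun y : SG G n =>
      ENNReal.ofReal (weight z (b⁻¹ * y * a) / weight z y) :=
    (((continuous_weight hz n).comp hc).measurable.div
      (continuous_weight hz n).measurable).ennreal_ofReal
  have h1 : (fun y : SG G n => ENNReal.ofReal (weight z y)) =
      (fun y => ENNReal.ofReal (weight z (b⁻¹ * y * a))) ∘ fun y => b * y * a⁻¹ := by
    ext y
    simp [mul_assoc]
  have h2 : (fun y : SG G n => ENNReal.ofReal (weight z (b⁻¹ * y * a))) =
      (fun y => ENNReal.ofReal (weight z y)) *
        fun y => ENNReal.ofReal (weight z (b⁻¹ * y * a) / weight z y) := by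
    ext y
    rw [Pi.mul_apply, ← ENNReal.ofReal_mul (weight_pos hz0 y).le,
      mul_div_cancel₀ _ (weight_pos hz0 y).ne']
  rw [ewens_eq_smul hz hz0, Measure.map_smul, withDensity_smul_measure,
    ← withDensity_mul _ hw hD, ← h2]
  conv_lhs => rw [h1]
  rw [map_withDensity_comp _ hS hw', map_mul_mul_wreathHaar]

/-- The measure of $VW$ is that of the preimage of $V$ under $W^{-1}$, so the inverse appears on the
left. Both sides are compared on the stages containing `W`, where `map_mul_mul_ewens` applies. -/
theorem IsEwensLimit.map_act_inv {z : ConjClasses G → ℂ}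
    (hz : Continuous fun g : G => z (ConjClasses.mk g)) (hz0 : ∀ c, z c ≠ 0)
    {μ : Measure (Virtual G)} (hμ : IsEwensLimit z μ) (W : SInf G × SInf G) :
    μ.map (Virtual.act W⁻¹) = μ.withDensity fun x => ENNReal.ofReal (density z x W) := by
  have := hμ.isProbabilityMeasure
  obtain ⟨N, hN⟩ := exists_inStage W
  refine Virtual.measure_ext N fun n hn => ?_
  obtain ⟨⟨a, ha⟩, ⟨b, hb⟩⟩ := hN.mono hn
  have hS : Measurable fun y : SG G n => b * y * a⁻¹ :=
    ((continuous_const.mul continuous_id).mul continuous_const).measurable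
  have hD : Measurable fun y : SG G n =>
      ENNReal.ofReal (weight z (b⁻¹ * y * a) / weight z y) :=
    (((continuous_weight hz n).comp ((continuous_const.mul continuous_id).mul
      continuous_const)).measurable.div (continuous_weight hz n).measurable).ennreal_ofReal
  have h1 : Virtual.coord n ∘ Virtual.act W⁻¹ =
      (fun y : SG G n => b * y * a⁻¹) ∘ Virtual.coord n := by
    ext1 x
    rw [Function.comp_apply, Virtual.coord_act W⁻¹ x n a⁻¹ b⁻¹ (by rw [map_inv, ha]; rfl)
      (by rw [map_inv, hb]; rfl), inv_inv]
    rfl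
  have h2 : (fun x => ENNReal.ofReal (density z x W)) =
      (fun y : SG G n => ENNReal.ofReal (weight z (b⁻¹ * y * a) / weight z y)) ∘
        Virtual.coord n := by
    ext1 x
    rw [density_eq_div hz0 (hN.mono hn), Virtual.coord_act W x n a b ha hb]
    rfl
  rw [Measure.map_map (Virtual.measurable_coord n) (Virtual.continuous_act _).measurable, h1,
    ← Measure.map_map hS (Virtual.measurable_coord n), h2,
    map_withDensity_comp _ (Virtual.measurable_coord n) hD, hμ.map_coord,
    map_mul_mul_ewens hz hz0]

theorem IsEwensLimit.quasiInvariant {z : ConjClasses G → ℂ}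
    (hz : Continuous fun g : G => z (ConjClasses.mk g)) (hz0 : ∀ c, z c ≠ 0)
    {μ : Measure (Virtual G)} (hμ : IsEwensLimit z μ) : QuasiInvariant μ := by
  intro W
  -- The image under `W` itself has the density belonging to `W⁻¹`; its strict positivity gives the
  -- converse absolute continuity.
  have h := hμ.map_act_inv hz hz0 W⁻¹
  rw [inv_inv] at h
  refine ⟨(Virtual.continuous_act W).measurable, ?_, ?_⟩
  · rw [h]
    exact withDensity_absolutelyContinuous _ _
  · rw [h]
    exact withDensity_absolutelyContinuous'
      (continuous_density hz hz0 W⁻¹).measurable.ennreal_ofReal.aemeasurable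
      (Filter.Eventually.of_forall fun x => (ENNReal.ofReal_pos.2 (density_pos hz0 x _)).ne')

end Limit

end WreathEwens

end

/-! ### The main theorem -/

open WreathEwens
theorem mainTheorem7 {G : Type*} [Group G] [TopologicalSpace G] [IsTopologicalGroup G]
    [CompactSpace G] [T2Space G] [MeasurableSpace G] [BorelSpace G]
    (z : ConjClasses G → ℂ) (hz : Continuous fun g : G => z (ConjClasses.mk g))
    (hz0 : ∀ c, z c ≠ 0) :
    (∃! μ : Measure (Virtual G), IsEwensLimit z μ) ∧
    (∀ (W : SInf G × SInf G) (n : ℕ), InStage n W → ∀ (x : Virtual G) (c : ConjClasses G),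
      cocycle c x W = (cycleCount ((x.act W).coord n) c : ℤ) - cycleCount (x.coord n) c) ∧
    ∀ μ : Measure (Virtual G), IsEwensLimit z μ →
      QuasiInvariant μ ∧
      ∀ W : SInf G × SInf G,
        (μ.map (Virtual.act W⁻¹)).rnDeriv μ =ᵐ[μ] (fun x => ENNReal.ofReal (density z x W)) ∧
        ∀ V : Set (Virtual G), MeasurableSet V →
          MeasurableSet (Virtual.act W '' V) ∧
          μ (Virtual.act W '' V) = ∫⁻ x in V, ENNReal.ofReal (density z x W) ∂μ := by
  refine ⟨existsUnique_isEwensLimit hz hz0, fun W n hW x c => cocycle_eq hW x c,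
    fun μ hμ => ⟨hμ.quasiInvariant hz hz0, fun W => ?_⟩⟩
  have := hμ.isProbabilityMeasure
  have hact := (Virtual.continuous_act W⁻¹).measurable
  refine ⟨?_, fun V hV => ?_⟩
  · rw [hμ.map_act_inv hz hz0]
    exact Measure.rnDeriv_withDensity μ (continuous_density hz hz0 W).measurable.ennreal_ofReal
  · rw [Virtual.image_act]
    refine ⟨hact hV, ?_⟩
    rw [← Measure.map_apply hact hV, hμ.map_act_inv hz hz0, withDensity_apply _ hV]
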